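/- **Setting.** Let $d\ge 1$. For $v\in\mathbb Z^d$ put $|v|=\sum_i|v_i|$, and let $d_v^-$ be the number of nearest neighbours $u$ of $v$ in $\mathbb Z^d$ with $|u|=|v|-1$. For $\lambda\in[0,1)$ the biased random walk $\mathrm{RW}_\lambda=(X_n)_{n\ge0}$, $X_n=(X_n^1,\dots,X_n^d)$, is the Markov chain on $\mathbb Z^d$ which moves only between nearest neighbours, with transition probabilities, for $u$ a nearest neighbour of $v$, $$p_\lambda(v,u)=\begin{cases}\frac1{2d}, & v=0,\\[2pt] \frac{\lambda}{2d+(\lambda-1)d_v^-}, & v\ne0,\ |u|=|v|-1,\\[2pt] \frac{1}{2d+(\lambda-1)d_v^-}, & \text{otherwise.}\end{cases}$$ Let $s_0=\frac12\ln\lambda$ (with $s_0=-\infty$ if $\lambda=0$), $\rho_\lambda=\frac{2\sqrt\lambda}{1+\lambda}$, and for $s\in\mathbb R^d$ let $$\psi(s)=N(s)\frac{\rho_\lambda}{d}+\frac1{d(1+\lambda)}\sum_{i=1}^d\left(\lambda e^{-s_i}+e^{s_i}\right)I_{\{s_i\ge s_0\}},\qquad N(s)=\sum_{i=1}^d I_{\{s_i<s_0\}},$$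 $$\Lambda^*(x)=\sup_{s\in\mathbb R^d}\{(s,x)-\ln\psi(s)\}\in(-\infty,\infty],\qquad x\in\mathbb R^d.$$ **Theorem (LDP).** Fix $\lambda\in[0,1)$ if $d\ge2$, and $\lambda\in(0,1)$ if $d=1$. Let $(X_n)$ be $\mathrm{RW}_\lambda$ started at any fixed point of $\mathbb Z^d$. **(i)** $\Lambda^*$ is a good rate function on $\mathbb R^d$ (values in $[0,\infty]$, lower semicontinuous, compact sublevel sets), and the sequence $\frac1n(|X_n^1|,\dots,|X_n^d|)$ satisfies the large deviation principle with rate function $\Lambda^*$: with $\mu_n$ the law of $\frac1n(|X_n^1|,\dots,|X_n^d|)$, $$\limsup_{n\to\infty}\tfrac1n\ln\mu_n(F)\le-\inf_F\Lambda^*\ (F\text{ closed}),\qquad \liminf_{n\to\infty}\tfrac1n\ln\mu_n(G)\ge-\inf_G\Lambda^*\ (G\text{ open}).$$ If $\lambda\in(0,1)$, then $$\{\Lambda^*<\infty\}=\Big\{x\in[0,\infty)^d: 0\le \sum_i x_i\le1\Big\},\qquad \{\Lambda^*=0\}=\Big\{\Big(\tfrac{1-\lambda}{d(1+\lambda)},\dots,\tfrac{1-\lambda}{d(1+\lambda)}\Big)\Big\}.$$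 If $d\ge2$ and $\lambda=0$, then $$\{\Lambda^*<\infty\}=\Big\{x\in[0,\infty)^d:\sum_i x_i=1\Big\},\qquad \{\Lambda^*=0\}=\Big\{\Big(\tfrac1d,\dots,\tfrac1d\Big)\Big\}.$$ **(ii)** (With the convention $0\ln0=0$.) If $d=1$ and $\lambda\in(0,1)$, then $$\Lambda^*(x)=\tfrac x2\ln\lambda-\ln\rho_\lambda+(1+x)\ln\sqrt{1+x}+(1-x)\ln\sqrt{1-x}$$ for $x\in[0,1]$, and $\Lambda^*(x)=+\infty$ otherwise. If $d=2$ and $\lambda\in(0,1)$, then $\Lambda^*(x)=\frac12(x_1+x_2)\ln\lambda-\ln\rho_\lambda+\overline{\Lambda^*}(x)$ for $x_1,x_2\ge0$, $x_1+x_2\le1$, and $\Lambda^*(x)=+\infty$ otherwise. Here, with $D(x)=(x_1^2-x_2^2)^2+1-2(x_1^2+x_2^2)$, for $x_1+x_2<1$ $$\overline{\Lambda^*}(x)=x_1\ln\frac{2x_1+(x_1^2-x_2^2+1)}{\sqrt{D(x)}}+x_2\ln\frac{2x_2+(x_2^2-x_1^2+1)}{\sqrt{D(x)}}-\ln\frac{(x_1^2-x_2^2+1)+(x_2^2-x_1^2+1)}{\sqrt{D(x)}}+\ln2,$$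 and for $x_1+x_2=1$, where $D(x)=0$, $\overline{\Lambda^*}(x)=2\ln2+x_1\ln x_1+x_2\ln x_2$ (the continuous extension of this expression). If $d\ge2$ and $\lambda=0$, then $\Lambda^*(x)=\ln d+\sum_{i=1}^d x_i\ln x_i$ for $x\in[0,\infty)^d$ with $\sum_i x_i=1$, and $\Lambda^*(x)=+\infty$ otherwise. -/

import Mathlib

open MeasureTheory Filter Topology Set

noncomputable section

/-! ### Large deviation principle -/

/-- A good rate function: a lower semicontinuous function with values in `[0, ∞]` whose sublevel
sets at finite levels are compact. -/
structure IsGoodRateFunction {E : Type*} [TopologicalSpace E] (I : E → EReal) : Prop where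
  nonneg : ∀ x, 0 ≤ I x
  lowerSemicontinuous : LowerSemicontinuous I
  isCompact_sublevel : ∀ a : ℝ, IsCompact {x | I x ≤ (a : EReal)}

/-- The sequence of measures `μ n` satisfies the large deviation principle (with speed `n`) with
rate function `I`: upper bound on closed sets, lower bound on open sets. Here `ENNReal.log` takes
values in `[-∞, ∞]`, with `log 0 = -∞`, and the infimum over the empty set is `+∞`. -/
structure SatisfiesLDP {E : Type*} [TopologicalSpace E] [MeasurableSpace E]
    (μ : ℕ → Measure E) (I : E → EReal) : Prop where
  upper : ∀ F : Set E, IsClosed F →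
    limsup (fun n : ℕ => (((n : ℝ)⁻¹ : ℝ) : EReal) * ENNReal.log (μ n F)) atTop
      ≤ -(⨅ x ∈ F, I x)
  lower : ∀ G : Set E, IsOpen G →
    -(⨅ x ∈ G, I x)
      ≤ liminf (fun n : ℕ => (((n : ℝ)⁻¹ : ℝ) : EReal) * ENNReal.log (μ n G)) atTop

/-! ### The biased random walk on `ℤ^d` -/

/-- The graph distance from `v` to the origin, `|v| = ∑ |v_i|`. -/
def graphNorm {d : ℕ} (v : Fin d → ℤ) : ℕ := ∑ i, (v i).natAbs

/-- Nearest neighbours in `ℤ^d`. -/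
def LatticeAdj {d : ℕ} (v u : Fin d → ℤ) : Prop := graphNorm (v - u) = 1

/-- `d_v^-`: the number of edges from `v` to the sphere of radius `|v| - 1`. -/
def downDegree {d : ℕ} (v : Fin d → ℤ) : ℕ :=
  {u : Fin d → ℤ | LatticeAdj v u ∧ graphNorm u + 1 = graphNorm v}.ncard

open Classical in
/-- Transition probabilities `p_λ(v, u)` of the biased random walk on `ℤ^d` (each vertex has
degree `2 d`). -/
def biasedTransition (d : ℕ) (lam : ℝ) (v u : Fin d → ℤ) : ℝ :=
  if LatticeAdj v u then
    if v = 0 then 1 / (2 * d)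
    else if graphNorm u + 1 = graphNorm v then
      lam / (2 * d + (lam - 1) * downDegree v)
    else 1 / (2 * d + (lam - 1) * downDegree v)
  else 0

/-- `X` is, under `P`, the Markov chain on `ℤ^d` with the transition probabilities of the biased
random walk with parameter `lam`, started at `x₀`. -/
structure IsBiasedRW {Ω : Type*} [MeasurableSpace Ω] (P : Measure Ω) {d : ℕ} (lam : ℝ)
    (x₀ : Fin d → ℤ) (X : ℕ → Ω → (Fin d → ℤ)) : Prop where
  measurable : ∀ n, Measurable (X n)
  start : ∀ᵐ ω ∂P, X 0 ω = x₀
  step : ∀ (n : ℕ) (γ : ℕ → Fin d → ℤ),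
    P.real {ω | ∀ k ≤ n + 1, X k ω = γ k} =
      P.real {ω | ∀ k ≤ n, X k ω = γ k} * biasedTransition d lam (γ n) (γ (n + 1))

/-- The scaled reflected position `(1/n) (|X_n^1|, …, |X_n^d|)`. -/
def scaledReflected {Ω : Type*} {d : ℕ} (X : ℕ → Ω → (Fin d → ℤ)) (n : ℕ) (ω : Ω) : Fin d → ℝ :=
  fun i => (1 / (n : ℝ)) * |(X n ω i : ℝ)|

/-! ### The rate function -/

/-- `s₀(λ) = (1/2) ln λ`, equal to `-∞` for `λ = 0`. -/
def sZero (lam : ℝ) : EReal := if lam = 0 then ⊥ else ((1 / 2 * Real.log lam : ℝ) : EReal)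

/-- `ρ_λ = 2 √λ / (1 + λ)`. -/
def rhoLam (lam : ℝ) : ℝ := 2 * √lam / (1 + lam)

open Classical in
/-- `N(s)`: the number of coordinates with `s_i < s₀`. -/
def numBelow {d : ℕ} (lam : ℝ) (s : Fin d → ℝ) : ℕ :=
  (Finset.univ.filter fun i => (s i : EReal) < sZero lam).card

open Classical in
/-- The function `ψ`. -/
def psi {d : ℕ} (lam : ℝ) (s : Fin d → ℝ) : ℝ :=
  numBelow lam s * (rhoLam lam / d) +
    1 / (d * (1 + lam)) *
      ∑ i, if sZero lam ≤ (s i : EReal) then lam * Real.exp (-s i) + Real.exp (s i) else 0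

/-- `Λ*(x) = sup_s {(s, x) - ln ψ(s)}`, with values in the extended reals. -/
def rateFn {d : ℕ} (lam : ℝ) (x : Fin d → ℝ) : EReal :=
  ⨆ s : Fin d → ℝ, ((∑ i, s i * x i - Real.log (psi lam s) : ℝ) : EReal)

/-- The function `Λ̄*` in dimension two, on `{x₁, x₂ ≥ 0, x₁ + x₂ ≤ 1}`. The quantity under the
root vanishes exactly on the segment `x₁ + x₂ = 1`, where `Λ̄*` is given by the continuous
extension of the first expression. -/
def rateBarTwo (x₁ x₂ : ℝ) : ℝ :=
  if x₁ + x₂ < 1 then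
    x₁ * Real.log ((2 * x₁ + (x₁ ^ 2 - x₂ ^ 2 + 1)) /
        √((x₁ ^ 2 - x₂ ^ 2) ^ 2 + 1 - 2 * (x₁ ^ 2 + x₂ ^ 2)))
      + x₂ * Real.log ((2 * x₂ + (x₂ ^ 2 - x₁ ^ 2 + 1)) /
        √((x₁ ^ 2 - x₂ ^ 2) ^ 2 + 1 - 2 * (x₁ ^ 2 + x₂ ^ 2)))
      - Real.log (((x₁ ^ 2 - x₂ ^ 2 + 1) + (x₂ ^ 2 - x₁ ^ 2 + 1)) /
        √((x₁ ^ 2 - x₂ ^ 2) ^ 2 + 1 - 2 * (x₁ ^ 2 + x₂ ^ 2)))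
      + Real.log 2
  else 2 * Real.log 2 + x₁ * Real.log x₁ + x₂ * Real.log x₂

end

/-! The coordinatewise absolute value of the walk is itself Markov: in each coordinate the outward
move has weight 1 and the inward move weight λ, and on a wall both moves go outward, with total
weight 2. Hence every probability in the theorem is an iterate of `reflStep` applied to an indicator
(`IsBiasedRW.map_scaledReflected`), and the LDP reduces to one-sided inequalities for this operator.

Upper bound. If a_i b_i = λ, the numerator of `reflStep` multiplies the product of the a_i^{y_i} +
b_i^{y_i} by ∑ (a_i + b_i), on the walls as well, while the denominator is at least d(1+λ)
(`reflStep_prod_le`). Take a_i = e^{s_i}, after raising s_i to s₀ if it lies below: this lowers a_i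
+ λ/a_i and does not lower s·y. The factor is then exactly ψ(s). Exponential Chebyshev controls each
half-space {`tiltValue` > a}, and finitely many of these cover the part of a closed set lying in the
orthant.

Lower bound. Let s be stationary for a point x with positive coordinates (`IsTilt`). Reweighting by
e^{s·y} gives a walk with drift x. Started far enough from the walls, it avoids them and ends near
nx with probability at least 1/2; this is encoded in the explicit subsolution `confinedBound`. Such
points x suffice, because moving a point of finite rate towards the zero of Λ* reaches one and, by
convexity, does not raise the rate.

Rate function. The tangent inequality for exp shows that a stationary s maximises
(`IsTilt.tiltValue_le`). Solving the stationarity equation gives the closed forms in d = 1, 2 where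
∑ x_i < 1. On the face ∑ x_i = 1 the supremum is found by letting s tend to infinity
(`rateFn_of_sum_eq_one`). -/

/-- The one-step operator of the reflected walk `(|X^1|, …, |X^d|)` acting on functions. -/
noncomputable def reflStep {d : ℕ} (lam : ℝ) (G : (Fin d → ℕ) → ℝ) (y : Fin d → ℕ) : ℝ :=
  (∑ i, if y i = 0 then 2 * G (y + Pi.single i 1)
    else G (y + Pi.single i 1) + lam * G (y - Pi.single i 1)) /
    ∑ i, if y i = 0 then 2 else 1 + lam

/-- The coordinatewise absolute value of a lattice point. -/
def latticeAbs {d : ℕ} (v : Fin d → ℤ) : Fin d → ℕ := fun i => (v i).natAbs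

/-- The nearest neighbour of `v` in the direction `± e_i`. -/
def latticeNbr {d : ℕ} (v : Fin d → ℤ) (p : Fin d × Bool) : Fin d → ℤ :=
  Function.update v p.1 (v p.1 + if p.2 then 1 else -1)

/-! ### Neighbours in ℤ^d and the projection of the transition kernel to the orthant. -/

section Lattice

variable {d : ℕ}

theorem graphNorm_update (v : Fin d → ℤ) (i : Fin d) (a : ℤ) :
    graphNorm (Function.update v i a) + (v i).natAbs = graphNorm v + a.natAbs := by
  unfold graphNorm
  rw [← Finset.add_sum_erase _ _ (Finset.mem_univ i), ← Finset.add_sum_erase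
    (f := fun i => (v i).natAbs) _ (Finset.mem_univ i)]
  have : ∑ x ∈ Finset.univ.erase i, (Function.update v i a x).natAbs
      = ∑ x ∈ Finset.univ.erase i, (v x).natAbs := by
    refine Finset.sum_congr rfl fun j hj => ?_
    rw [Function.update_of_ne (Finset.ne_of_mem_erase hj)]
  rw [this, Function.update_self]
  ring

theorem latticeAdj_iff (v u : Fin d → ℤ) : LatticeAdj v u ↔ ∃ p, latticeNbr v p = u := by
  unfold LatticeAdj latticeNbr
  constructor
  · intro h
    have hne : ∃ i, v i ≠ u i := by
      by_contra! hc
      simp [graphNorm, hc] at h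
    obtain ⟨i, hi⟩ := hne
    have h1 : graphNorm (v - u) = (v i - u i).natAbs +
        ∑ x ∈ Finset.univ.erase i, (v x - u x).natAbs := by
      unfold graphNorm
      rw [← Finset.add_sum_erase _ _ (Finset.mem_univ i)]
      simp
    have h2 : (v i - u i).natAbs ≠ 0 := by omega
    have h3 : ∑ x ∈ Finset.univ.erase i, (v x - u x).natAbs = 0 := by omega
    rw [Finset.sum_eq_zero_iff] at h3
    have h4 : (v i - u i).natAbs = 1 := by omega
    refine ⟨(i, decide (v i < u i)), ?_⟩
    ext j
    by_cases hj : j = i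
    · subst hj
      simp only [Function.update_self, decide_eq_true_eq]
      split_ifs <;> omega
    · simp only [Function.update_of_ne hj]
      have := h3 j (Finset.mem_erase.2 ⟨hj, Finset.mem_univ _⟩)
      omega
  · rintro ⟨⟨i, b⟩, rfl⟩
    unfold graphNorm
    rw [Finset.sum_eq_single i]
    · cases b <;> simp
    · intro j _ hj
      simp [Function.update_of_ne hj]
    · simp

theorem latticeNbr_injective (v : Fin d → ℤ) : Function.Injective (latticeNbr v) := by
  rintro ⟨i, b⟩ ⟨j, c⟩ h
  unfold latticeNbr at h
  have hi := congrFun h i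
  by_cases hij : i = j
  · subst hij
    cases b <;> cases c <;> simp at hi ⊢
  · simp only [Function.update_self, Function.update_of_ne hij] at hi
    cases b <;> simp at hi

/-- The distance to the origin drops exactly when a nonzero coordinate moves towards zero, which it
can do in one way. -/
theorem downDegree_eq (v : Fin d → ℤ) :
    downDegree v = (Finset.univ.filter fun i => v i ≠ 0).card := by
  unfold downDegree
  have : {u : Fin d → ℤ | LatticeAdj v u ∧ graphNorm u + 1 = graphNorm v} =
      (fun i => latticeNbr v (i, decide (v i < 0))) ''
        ((Finset.univ.filter fun i => v i ≠ 0 : Finset (Fin d)) : Set (Fin d)) := by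
    ext u
    simp only [latticeAdj_iff, mem_ofPred_eq, Finset.coe_filter, Finset.mem_univ, true_and,
      mem_image]
    constructor
    · rintro ⟨⟨⟨i, b⟩, rfl⟩, h⟩
      have := graphNorm_update v i (v i + if b then 1 else -1)
      unfold latticeNbr at h
      simp only at h
      refine ⟨i, ?_, ?_⟩
      · cases b <;> simp at h this <;> omega
      · congr 2
        cases b <;> simp at h this ⊢ <;> omega
    · rintro ⟨i, hi, rfl⟩
      refine ⟨⟨_, rfl⟩, ?_⟩
      have := graphNorm_update v i (v i + if decide (v i < 0) then 1 else -1)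
      unfold latticeNbr
      simp only at this ⊢
      simp only [decide_eq_true_eq] at this ⊢
      split_ifs at this ⊢ <;> omega
  rw [this, Set.InjOn.ncard_image, Set.ncard_coe_finset]
  intro i _ j _ h
  exact congrArg Prod.fst (latticeNbr_injective v h)

theorem degree_weight_eq (lam : ℝ) (v : Fin d → ℤ) :
    2 * (d : ℝ) + (lam - 1) * downDegree v =
      ∑ i, if latticeAbs v i = 0 then 2 else 1 + lam := by
  have : ∀ i, (if latticeAbs v i = 0 then (2 : ℝ) else 1 + lam) =
      2 + (lam - 1) * (if v i ≠ 0 then 1 else 0) := by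
    intro i
    by_cases h : v i = 0
    · simp [latticeAbs, h]
    · simp [latticeAbs, h]; ring
  simp_rw [this, Finset.sum_add_distrib, ← Finset.mul_sum, downDegree_eq]
  simp only [Finset.sum_const, Finset.card_univ, Fintype.card_fin, nsmul_eq_mul,
    Finset.sum_boole]
  ring

theorem biasedTransition_latticeNbr (lam : ℝ) (v : Fin d → ℤ) (p : Fin d × Bool) :
    biasedTransition d lam v (latticeNbr v p) =
      (if (v p.1 + if p.2 then 1 else -1).natAbs + 1 = (v p.1).natAbs then lam else 1) /
        ∑ i, if latticeAbs v i = 0 then 2 else 1 + lam := by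
  rw [← degree_weight_eq]
  unfold biasedTransition
  rw [if_pos ((latticeAdj_iff _ _).2 ⟨p, rfl⟩)]
  have h := graphNorm_update v p.1 (v p.1 + if p.2 then 1 else -1)
  -- At the origin no neighbour is closer and `downDegree` vanishes, so the separate clause of the
  -- definition agrees with the general formula.
  by_cases h0 : v = 0
  · subst h0
    simp [downDegree_eq]
  · rw [if_neg h0]
    have e : graphNorm (latticeNbr v p) + 1 = graphNorm v ↔
        (v p.1 + if p.2 then 1 else -1).natAbs + 1 = (v p.1).natAbs := by
      unfold latticeNbr
      omega
    simp only [e]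
    split_ifs <;> rfl

theorem latticeAbs_latticeNbr_up {v : Fin d → ℤ} {i : Fin d} {b : Bool}
    (h : (v i + if b then 1 else -1).natAbs = (v i).natAbs + 1) :
    latticeAbs (latticeNbr v (i, b)) = latticeAbs v + Pi.single i 1 := by
  ext j
  unfold latticeAbs latticeNbr
  by_cases hj : j = i
  · subst hj
    simpa using h
  · simp [hj]

theorem latticeAbs_latticeNbr_down {v : Fin d → ℤ} {i : Fin d} {b : Bool}
    (h : (v i + if b then 1 else -1).natAbs + 1 = (v i).natAbs) :
    latticeAbs (latticeNbr v (i, b)) = latticeAbs v - Pi.single i 1 := by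
  ext j
  unfold latticeAbs latticeNbr
  by_cases hj : j = i
  · subst hj
    simp only [Function.update_self, Pi.sub_apply, Pi.single_eq_same]
    omega
  · simp [hj]

/-- Lumpability: over a nonzero coordinate one of the two neighbours goes out and the other in; over
a zero coordinate both project to the same outward point, whence the factor 2. -/
theorem sum_latticeNbr_eq_reflStep (lam : ℝ) (G : (Fin d → ℕ) → ℝ) (v : Fin d → ℤ) :
    ∑ p, biasedTransition d lam v (latticeNbr v p) * G (latticeAbs (latticeNbr v p)) =
      reflStep lam G (latticeAbs v) := by
  simp_rw [biasedTransition_latticeNbr, div_mul_eq_mul_div, ← Finset.sum_div]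
  unfold reflStep
  congr 1
  rw [Fintype.sum_prod_type]
  refine Finset.sum_congr rfl fun i _ => ?_
  rw [Fintype.sum_bool]
  rcases lt_trichotomy (v i) 0 with h | h | h
  · have h1 : (v i + if true then 1 else -1).natAbs + 1 = (v i).natAbs := by simp; omega
    have h2 : (v i + if false then 1 else -1).natAbs = (v i).natAbs + 1 := by simp; omega
    rw [latticeAbs_latticeNbr_up h2, latticeAbs_latticeNbr_down h1, if_pos h1,
      if_neg (by simp only at h2 ⊢; omega), if_neg (by simp [latticeAbs]; omega)]
    ring
  · have h1 : (v i + if true then 1 else -1).natAbs = (v i).natAbs + 1 := by simp [h]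
    have h2 : (v i + if false then 1 else -1).natAbs = (v i).natAbs + 1 := by simp [h]
    rw [latticeAbs_latticeNbr_up h2, latticeAbs_latticeNbr_up h1,
      if_neg (by simp only at h1 ⊢; omega), if_neg (by simp only at h2 ⊢; omega),
      if_pos (by simp [latticeAbs]; omega)]
    ring
  · have h1 : (v i + if true then 1 else -1).natAbs = (v i).natAbs + 1 := by simp; omega
    have h2 : (v i + if false then 1 else -1).natAbs + 1 = (v i).natAbs := by simp; omega
    rw [latticeAbs_latticeNbr_up h1, latticeAbs_latticeNbr_down h2, if_pos h2,
      if_neg (by simp only at h1 ⊢; omega), if_neg (by simp [latticeAbs]; omega)]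
    ring

theorem biasedTransition_latticeNbr_nonneg {lam : ℝ} (hlam : 0 ≤ lam) (v : Fin d → ℤ)
    (p : Fin d × Bool) : 0 ≤ biasedTransition d lam v (latticeNbr v p) := by
  rw [biasedTransition_latticeNbr]
  refine div_nonneg (by split_ifs <;> positivity) (Finset.sum_nonneg fun i _ => ?_)
  split_ifs <;> positivity

theorem tsum_biasedTransition {lam : ℝ} (hlam : 0 ≤ lam) {G : (Fin d → ℕ) → ℝ}
    (hG : ∀ y, 0 ≤ G y) (v : Fin d → ℤ) :
    ∑' u, ENNReal.ofReal (biasedTransition d lam v u) * ENNReal.ofReal (G (latticeAbs u)) =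
      ENNReal.ofReal (reflStep lam G (latticeAbs v)) := by
  rw [← (latticeNbr_injective v).tsum_eq, tsum_fintype, ← sum_latticeNbr_eq_reflStep,
    ENNReal.ofReal_sum_of_nonneg]
  · refine Finset.sum_congr rfl fun p _ => ?_
    rw [ENNReal.ofReal_mul (biasedTransition_latticeNbr_nonneg hlam v p)]
  · exact fun p _ => mul_nonneg (biasedTransition_latticeNbr_nonneg hlam v p) (hG _)
  · intro u hu
    by_contra hc
    have : ¬ LatticeAdj v u := fun h => hc ((latticeAdj_iff v u).1 h)
    simp [biasedTransition, this] at hu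

theorem reflStep_nonneg {lam : ℝ} (hlam : 0 ≤ lam) {G : (Fin d → ℕ) → ℝ}
    (hG : ∀ y, 0 ≤ G y) (y : Fin d → ℕ) : 0 ≤ reflStep lam G y := by
  unfold reflStep
  refine div_nonneg (Finset.sum_nonneg fun i _ => ?_) (Finset.sum_nonneg fun i _ => ?_)
  · have := hG (y + Pi.single i 1)
    have := hG (y - Pi.single i 1)
    split_ifs <;> positivity
  · split_ifs <;> positivity

theorem reflStep_iterate_nonneg {lam : ℝ} (hlam : 0 ≤ lam) {G : (Fin d → ℕ) → ℝ}
    (hG : ∀ y, 0 ≤ G y) (n : ℕ) : ∀ y, 0 ≤ (reflStep lam)^[n] G y := by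
  induction n with
  | zero => exact hG
  | succ n ih =>
    rw [Function.iterate_succ_apply']
    exact reflStep_nonneg hlam ih

end Lattice

/-! ### From path probabilities to iterates of the one-step operator. -/

section Chain

theorem scaledReflected_eq {Ω : Type*} {d : ℕ} (X : ℕ → Ω → (Fin d → ℤ)) (n : ℕ) (ω : Ω) :
    scaledReflected X n ω = fun i => (latticeAbs (X n ω) i : ℝ) / n := by
  funext i
  simp only [scaledReflected, latticeAbs, Nat.cast_natAbs, Int.cast_abs]
  ring

variable {Ω : Type*} [MeasurableSpace Ω] {P : Measure Ω} {d : ℕ}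
  {lam : ℝ} {x₀ : Fin d → ℤ} {X : ℕ → Ω → (Fin d → ℤ)}

/-- The hypothesis `step` speaks of complete paths only, so the event is partitioned according to
the history up to time n. -/
theorem IsBiasedRW.measure_pair [IsProbabilityMeasure P] (h : IsBiasedRW P lam x₀ X) (n : ℕ) (v u : Fin d → ℤ) :
    P {ω | X n ω = v ∧ X (n + 1) ω = u} =
      P {ω | X n ω = v} * ENNReal.ofReal (biasedTransition d lam v u) := by
  let H : Ω → (Fin (n + 1) → Fin d → ℤ) := fun ω k => X k ω
  have hH : Measurable H := measurable_pi_lambda _ fun k => h.measurable k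
  have hpart : ∀ A : Set Ω, MeasurableSet A → P A = ∑' γ, P (A ∩ H ⁻¹' {γ}) := by
    intro A hA
    rw [← measure_iUnion]
    · congr 1
      ext ω
      simp
    · intro γ γ' hne
      refine Set.disjoint_left.2 fun ω h1 h2 => hne ?_
      rw [← h1.2, ← h2.2]
    · exact fun γ => hA.inter (hH (measurableSet_singleton γ))
  have hm : ∀ k w, MeasurableSet {ω | X k ω = w} := fun k w =>
    h.measurable k (measurableSet_singleton w)
  rw [hpart _ (hm n v), hpart {ω | X n ω = v ∧ X (n + 1) ω = u} ((hm n v).inter (hm (n + 1) u)),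
    ← ENNReal.tsum_mul_right]
  refine tsum_congr fun γ => ?_
  by_cases hγ : γ (Fin.last n) = v
  -- Γ is the history γ followed by u; its values beyond time n + 1 play no role.
  · let Γ : ℕ → Fin d → ℤ := fun k => if hk : k < n + 1 then γ ⟨k, hk⟩ else u
    have e1 : {ω | X n ω = v ∧ X (n + 1) ω = u} ∩ H ⁻¹' {γ} = {ω | ∀ k ≤ n + 1, X k ω = Γ k} := by
      ext ω
      simp only [mem_inter_iff, mem_ofPred_eq, mem_preimage, mem_singleton_iff]
      constructor
      · rintro ⟨⟨_, h2⟩, h3⟩ k hk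
        by_cases hk' : k < n + 1
        · simp only [Γ, hk', dite_true, ← h3, H]
        · have : k = n + 1 := by omega
          subst this
          simpa [Γ] using h2
      · intro hk
        refine ⟨⟨?_, ?_⟩, ?_⟩
        · have := hk n (by omega)
          simp only [Γ, Nat.lt_succ_self, dite_true] at this
          rw [this, ← hγ]; rfl
        · simpa [Γ] using hk (n + 1) le_rfl
        · funext k
          have := hk k (by omega)
          simp only [Γ, k.2, dite_true] at this
          exact this
    have e2 : {ω | X n ω = v} ∩ H ⁻¹' {γ} = {ω | ∀ k ≤ n, X k ω = Γ k} := by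
      ext ω
      simp only [mem_inter_iff, mem_ofPred_eq, mem_preimage, mem_singleton_iff]
      constructor
      · rintro ⟨_, h3⟩ k hk
        have hk' : k < n + 1 := by omega
        simp only [Γ, hk', dite_true, ← h3, H]
      · intro hk
        refine ⟨?_, ?_⟩
        · have := hk n le_rfl
          simp only [Γ, Nat.lt_succ_self, dite_true] at this
          rw [this, ← hγ]; rfl
        · funext k
          have := hk k (by omega)
          simp only [Γ, k.2, dite_true] at this
          exact this
    have hs := h.step n Γ
    have g1 : Γ n = v := by simp only [Γ, Nat.lt_succ_self, dite_true]; exact hγ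
    have g2 : Γ (n + 1) = u := by simp [Γ]
    rw [g1, g2] at hs
    rw [e1, e2, ← ofReal_measureReal, hs, ENNReal.ofReal_mul measureReal_nonneg,
      ofReal_measureReal]
  · have e : ∀ A : Set Ω, A ⊆ {ω | X n ω = v} → A ∩ H ⁻¹' {γ} = ∅ := by
      intro A hA
      rw [Set.eq_empty_iff_forall_notMem]
      rintro ω ⟨h1, h2⟩
      refine hγ ?_
      have h2' : H ω = γ := h2
      rw [← hA h1, ← h2']
      rfl
    rw [e _ Subset.rfl, e _ fun ω hω => hω.1]
    simp

theorem IsBiasedRW.lintegral_succ [IsProbabilityMeasure P] (h : IsBiasedRW P lam x₀ X) (hlam : 0 ≤ lam)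
    {G : (Fin d → ℕ) → ℝ} (hG : ∀ y, 0 ≤ G y) (n : ℕ) :
    ∫⁻ ω, ENNReal.ofReal (G (latticeAbs (X (n + 1) ω))) ∂P =
      ∫⁻ ω, ENNReal.ofReal (reflStep lam G (latticeAbs (X n ω))) ∂P := by
  have key : ∀ k (g : (Fin d → ℤ) → ENNReal), ∫⁻ ω, g (X k ω) ∂P =
      ∑' v, g v * P {ω | X k ω = v} := by
    intro k g
    rw [← lintegral_map (measurable_of_countable g) (h.measurable k), lintegral_countable']
    refine tsum_congr fun v => ?_
    rw [Measure.map_apply (h.measurable k) (measurableSet_singleton v)]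
    rfl
  have hm : ∀ k w, MeasurableSet {ω | X k ω = w} := fun k w =>
    h.measurable k (measurableSet_singleton w)
  have hsplit : ∀ u, P {ω | X (n + 1) ω = u} =
      ∑' v, P {ω | X n ω = v} * ENNReal.ofReal (biasedTransition d lam v u) := by
    intro u
    simp_rw [← h.measure_pair]
    rw [← measure_iUnion]
    · congr 1
      ext ω
      simp
    · intro v v' hne
      refine Set.disjoint_left.2 fun ω h1 h2 => hne ?_
      rw [← h1.1, ← h2.1]
    · exact fun v => (hm n v).inter (hm (n + 1) u)
  rw [key (n + 1) fun v => ENNReal.ofReal (G (latticeAbs v)),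
    key n fun v => ENNReal.ofReal (reflStep lam G (latticeAbs v))]
  simp_rw [hsplit, ← tsum_biasedTransition hlam hG, ← ENNReal.tsum_mul_left,
    ← ENNReal.tsum_mul_right]
  rw [ENNReal.tsum_comm]
  refine tsum_congr fun v => tsum_congr fun u => ?_
  ring

/-- The induction peels off the last step and absorbs it into the test function, so G has to stay
general. -/
theorem IsBiasedRW.lintegral_eq [IsProbabilityMeasure P] (h : IsBiasedRW P lam x₀ X) (hlam : 0 ≤ lam) (n : ℕ) :
    ∀ {G : (Fin d → ℕ) → ℝ}, (∀ y, 0 ≤ G y) →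
    ∫⁻ ω, ENNReal.ofReal (G (latticeAbs (X n ω))) ∂P =
      ENNReal.ofReal ((reflStep lam)^[n] G (latticeAbs x₀)) := by
  induction n with
  | zero =>
    intro G _
    have : (fun ω => ENNReal.ofReal (G (latticeAbs (X 0 ω)))) =ᵐ[P]
        fun _ => ENNReal.ofReal (G (latticeAbs x₀)) := by
      filter_upwards [h.start] with ω hω
      rw [hω]
    rw [lintegral_congr_ae this]
    simp
  | succ n ih =>
    intro G hG
    rw [h.lintegral_succ hlam hG, ih (reflStep_nonneg hlam hG), Function.iterate_succ_apply]

theorem IsBiasedRW.measurable_scaledReflected (h : IsBiasedRW P lam x₀ X) (n : ℕ) :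
    Measurable (scaledReflected X n) :=
  (measurable_of_countable fun v : Fin d → ℤ => fun i => (1 / (n : ℝ)) * |(v i : ℝ)|).comp
    (h.measurable n)

theorem IsBiasedRW.map_scaledReflected [IsProbabilityMeasure P] (h : IsBiasedRW P lam x₀ X) (hlam : 0 ≤ lam) (n : ℕ)
    {A : Set (Fin d → ℝ)} (hA : MeasurableSet A) :
    P.map (scaledReflected X n) A = ENNReal.ofReal ((reflStep lam)^[n]
      ({y : Fin d → ℕ | (fun i => (y i : ℝ) / n) ∈ A}.indicator 1) (latticeAbs x₀)) := by
  rw [Measure.map_apply (h.measurable_scaledReflected n) hA, ← h.lintegral_eq hlam,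
    ← lintegral_indicator_one (h.measurable_scaledReflected n hA)]
  · refine lintegral_congr fun ω => ?_
    have e : ω ∈ scaledReflected X n ⁻¹' A ↔
        latticeAbs (X n ω) ∈ {y : Fin d → ℕ | (fun i => (y i : ℝ) / n) ∈ A} := by
      rw [mem_preimage, scaledReflected_eq]
      rfl
    by_cases hω : ω ∈ scaledReflected X n ⁻¹' A
    · simp [Set.indicator_of_mem hω, Set.indicator_of_mem (e.1 hω)]
    · simp [Set.indicator_of_notMem hω, Set.indicator_of_notMem (mt e.2 hω)]
  · exact fun y => Set.indicator_nonneg (fun _ _ => zero_le_one) _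

end Chain

/-! ### Supersolutions and subsolutions of the reflected operator. -/

section Operator

variable {d : ℕ} {lam : ℝ}

theorem reflStep_mono (hlam : 0 ≤ lam) {G G' : (Fin d → ℕ) → ℝ} (h : ∀ y, G y ≤ G' y)
    (y : Fin d → ℕ) : reflStep lam G y ≤ reflStep lam G' y := by
  unfold reflStep
  refine div_le_div_of_nonneg_right (Finset.sum_le_sum fun i _ => ?_)
    (Finset.sum_nonneg fun i _ => ?_)
  · split_ifs
    · linarith [h (y + Pi.single i 1)]
    · linarith [h (y + Pi.single i 1), mul_le_mul_of_nonneg_left (h (y - Pi.single i 1)) hlam]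
  · split_ifs <;> positivity

theorem reflStep_const_mul (c : ℝ) (G : (Fin d → ℕ) → ℝ) (y : Fin d → ℕ) :
    reflStep lam (fun z => c * G z) y = c * reflStep lam G y := by
  unfold reflStep
  rw [← mul_div_assoc, Finset.mul_sum]
  congr 1
  refine Finset.sum_congr rfl fun i _ => ?_
  split_ifs <;> ring

theorem reflStep_iterate_le (hlam : 0 ≤ lam) {G f : (Fin d → ℕ) → ℝ} {C c : ℝ} (hC : 0 ≤ C)
    (hc : 0 ≤ c) (hG : ∀ y, G y ≤ C * f y) (hf : ∀ y, reflStep lam f y ≤ c * f y) (n : ℕ) :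
    ∀ y, (reflStep lam)^[n] G y ≤ C * c ^ n * f y := by
  induction n with
  | zero => simpa using hG
  | succ n ih =>
    intro y
    rw [Function.iterate_succ_apply']
    refine (reflStep_mono hlam ih y).trans ?_
    rw [reflStep_const_mul, pow_succ]
    have := mul_le_mul_of_nonneg_left (hf y) (mul_nonneg hC (pow_nonneg hc n))
    linarith

theorem weight_pos (hd : 0 < d) (hlam : 0 ≤ lam) (y : Fin d → ℕ) :
    0 < ∑ i, if y i = 0 then (2 : ℝ) else 1 + lam := by
  have : Nonempty (Fin d) := ⟨⟨0, hd⟩⟩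
  refine Finset.sum_pos (fun i _ => ?_) Finset.univ_nonempty
  split_ifs <;> positivity

theorem weight_ge (hlam1 : lam ≤ 1) (y : Fin d → ℕ) :
    d * (1 + lam) ≤ ∑ i, if y i = 0 then (2 : ℝ) else 1 + lam := by
  have : (d : ℝ) * (1 + lam) = ∑ _i : Fin d, (1 + lam) := by
    rw [Finset.sum_const, Finset.card_univ, Fintype.card_fin, nsmul_eq_mul]
  rw [this]
  refine Finset.sum_le_sum fun i _ => ?_
  split_ifs <;> linarith

theorem weight_le (hlam1 : lam ≤ 1) (y : Fin d → ℕ) :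
    (∑ i, if y i = 0 then (2 : ℝ) else 1 + lam) ≤ 2 * d := by
  have : 2 * (d : ℝ) = ∑ _i : Fin d, 2 := by simp [mul_comm]
  rw [this]
  refine Finset.sum_le_sum fun i _ => ?_
  split_ifs <;> linarith

theorem prod_eq_mul_erase (g : Fin d → ℕ → ℝ) (i : Fin d) {y z : Fin d → ℕ}
    (h : ∀ j ≠ i, z j = y j) :
    ∏ j, g j (z j) = g i (z i) * ∏ j ∈ Finset.univ.erase i, g j (y j) := by
  rw [← Finset.mul_prod_erase _ _ (Finset.mem_univ i)]
  congr 1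
  exact Finset.prod_congr rfl fun j hj => by rw [h j (Finset.ne_of_mem_erase hj)]

theorem add_single_ne (y : Fin d → ℕ) (i : Fin d) :
    ∀ j ≠ i, (y + Pi.single i 1 : Fin d → ℕ) j = y j := fun j hj => by simp [hj]

theorem sub_single_ne (y : Fin d → ℕ) (i : Fin d) :
    ∀ j ≠ i, (y - Pi.single i 1 : Fin d → ℕ) j = y j := fun j hj => by simp [hj]

/-- A product of sums of the two characteristic exponentials is superharmonic up to the factor
`∑ (a_i + b_i) / (d (1 + λ))`; it is reflected without loss at the coordinate hyperplanes. -/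
theorem reflStep_prod_le (hd : 0 < d) (hlam : 0 ≤ lam) (hlam1 : lam ≤ 1) {a b : Fin d → ℝ}
    (ha : ∀ i, 0 ≤ a i) (hb : ∀ i, 0 ≤ b i) (hab : ∀ i, a i * b i = lam) (y : Fin d → ℕ) :
    reflStep lam (fun z => ∏ i, (a i ^ z i + b i ^ z i)) y ≤
      (∑ i, (a i + b i)) / (d * (1 + lam)) * ∏ i, (a i ^ y i + b i ^ y i) := by
  have hpos := weight_pos hd hlam y
  have hnum : (∑ i, if y i = 0 then 2 * ∏ j, (a j ^ (y + Pi.single i 1 : Fin d → ℕ) j +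
      b j ^ (y + Pi.single i 1 : Fin d → ℕ) j) else ∏ j, (a j ^ (y + Pi.single i 1 : Fin d → ℕ) j +
      b j ^ (y + Pi.single i 1 : Fin d → ℕ) j) + lam * ∏ j, (a j ^ (y - Pi.single i 1 : Fin d → ℕ) j +
      b j ^ (y - Pi.single i 1 : Fin d → ℕ) j)) = (∑ i, (a i + b i)) * ∏ i, (a i ^ y i + b i ^ y i) := by
    rw [Finset.sum_mul]
    refine Finset.sum_congr rfl fun i _ => ?_
    rw [prod_eq_mul_erase (fun j m => a j ^ m + b j ^ m) i (add_single_ne y i),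
      prod_eq_mul_erase (fun j m => a j ^ m + b j ^ m) i (sub_single_ne y i),
      prod_eq_mul_erase (fun j m => a j ^ m + b j ^ m) i (y := y) (z := y) fun _ _ => rfl]
    simp only [Pi.add_apply, Pi.sub_apply, Pi.single_eq_same]
    -- On the wall both sides carry 2(a_i + b_i). Off it this is the recurrence a^{m+2} + b^{m+2} +
    -- ab(a^m + b^m) = (a + b)(a^{m+1} + b^{m+1}), with ab = λ.
    rcases Nat.eq_zero_or_pos (y i) with h | h
    · simp [h]; ring
    · obtain ⟨m, hm⟩ := Nat.exists_eq_succ_of_ne_zero h.ne'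
      rw [if_neg h.ne', hm]
      simp only [Nat.succ_eq_add_one, Nat.add_sub_cancel, pow_succ]
      rw [← hab i]
      ring
  unfold reflStep
  rw [hnum, div_mul_eq_mul_div]
  have h1 : (0 : ℝ) < d * (1 + lam) := by positivity
  refine div_le_div_of_nonneg_left ?_ h1 (weight_ge hlam1 y)
  exact mul_nonneg (Finset.sum_nonneg fun i _ => add_nonneg (ha i) (hb i))
    (Finset.prod_nonneg fun i _ => add_nonneg (pow_nonneg (ha i) _) (pow_nonneg (hb i) _))

theorem reflStep_ge_up (hd : 0 < d) (hlam : 0 ≤ lam) (hlam1 : lam ≤ 1) {G : (Fin d → ℕ) → ℝ}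
    (hG : ∀ y, 0 ≤ G y) (y : Fin d → ℕ) (i : Fin d) :
    (1 / (2 * d)) * G (y + Pi.single i 1) ≤ reflStep lam G y := by
  have hpos := weight_pos hd hlam y
  unfold reflStep
  rw [one_div, inv_mul_eq_div]
  refine (div_le_div_of_nonneg_left (hG _) hpos (weight_le hlam1 y)).trans ?_
  refine div_le_div_of_nonneg_right ?_ hpos.le
  have key : ∀ j, 0 ≤ (if y j = 0 then 2 * G (y + Pi.single j 1)
      else G (y + Pi.single j 1) + lam * G (y - Pi.single j 1)) := fun j => by
    have := hG (y + Pi.single j 1)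
    have := hG (y - Pi.single j 1)
    split_ifs <;> positivity
  refine le_trans ?_ (Finset.single_le_sum (fun j _ => key j) (Finset.mem_univ i))
  have := hG (y + Pi.single i 1)
  have := mul_nonneg hlam (hG (y - Pi.single i 1))
  split_ifs <;> linarith

/-- Following one prescribed outward path costs at most a factor 2d per step. This moves the start
away from the walls at a price independent of n. -/
theorem reflStep_iterate_ge_up (hd : 0 < d) (hlam : 0 ≤ lam) (hlam1 : lam ≤ 1) (y z : Fin d → ℕ) :
    ∀ (G : (Fin d → ℕ) → ℝ), (∀ y, 0 ≤ G y) →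
    (1 / (2 * (d : ℝ))) ^ (∑ i, z i) * G (y + z) ≤ (reflStep lam)^[∑ i, z i] G y := by
  suffices ∀ (m : ℕ) (y z : Fin d → ℕ), ∑ i, z i = m → ∀ (G : (Fin d → ℕ) → ℝ), (∀ y, 0 ≤ G y) →
      (1 / (2 * (d : ℝ))) ^ m * G (y + z) ≤ (reflStep lam)^[m] G y from
    this _ y z rfl
  intro m
  induction m with
  | zero =>
    intro y z hz G _
    have : z = 0 := by
      rw [Finset.sum_eq_zero_iff] at hz
      exact funext fun i => hz i (Finset.mem_univ i)
    simp [this]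
  | succ m ih =>
    intro y z hz G hG
    have : ∃ i, z i ≠ 0 := by
      by_contra! hc
      simp [hc] at hz
    obtain ⟨i, hi⟩ := this
    obtain ⟨w, rfl⟩ : ∃ w, z = Pi.single i 1 + w :=
      ⟨z - Pi.single i 1, by
        ext j
        by_cases hj : j = i
        · subst hj; simp; omega
        · simp [hj]⟩
    have hw : ∑ j, w j = m := by
      simp only [Pi.add_apply, Finset.sum_add_distrib, Finset.sum_pi_single', Finset.mem_univ,
        if_true] at hz
      omega
    rw [Function.iterate_succ_apply', ← add_assoc]
    refine le_trans ?_ (reflStep_ge_up hd hlam hlam1 (reflStep_iterate_nonneg hlam hG m) y i)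
    rw [pow_succ', mul_assoc]
    exact mul_le_mul_of_nonneg_left (ih _ w hw G hG) (by positivity)

/-- A lower bound for the probability that the tilted walk, started at `y`, has not left the
positive orthant and is within `η` of `c` in each coordinate after `k` steps. -/
noncomputable def confinedBound (r x c : Fin d → ℝ) (η : ℝ) (k : ℕ) (y : Fin d → ℕ) : ℝ :=
  1 - ∑ i, (r i ^ y i + ((y i + k * x i - c i) ^ 2 + k) / η ^ 2)

theorem confinedBound_update {r x c : Fin d → ℝ} {η : ℝ} {k : ℕ} {y z : Fin d → ℕ} {i : Fin d}
    (h : ∀ j ≠ i, z j = y j) :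
    confinedBound r x c η k z = confinedBound r x c η k y +
      (r i ^ y i + ((y i + k * x i - c i) ^ 2 + k) / η ^ 2) -
      (r i ^ z i + ((z i + k * x i - c i) ^ 2 + k) / η ^ 2) := by
  unfold confinedBound
  rw [← Finset.add_sum_erase _ _ (Finset.mem_univ i), ← Finset.add_sum_erase
    (f := fun i => (r i ^ y i + ((y i + k * x i - c i) ^ 2 + k) / η ^ 2)) _ (Finset.mem_univ i)]
  have : ∑ j ∈ Finset.univ.erase i, (r j ^ z j + ((z j + k * x j - c j) ^ 2 + k) / η ^ 2) =
      ∑ j ∈ Finset.univ.erase i, (r j ^ y j + ((y j + k * x j - c j) ^ 2 + k) / η ^ 2) :=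
    Finset.sum_congr rfl fun j hj => by rw [h j (Finset.ne_of_mem_erase hj)]
  rw [this]
  ring

/-- Under the tilted step, with probabilities a_i/Z outward and b_i/Z inward, r_i^{y_i} with r_i =
b_i/a_i is harmonic (gambler's ruin). The squared deviation of the predicted endpoint grows on
average by at most 1 per step, which the added k pays for. Together these bound the ruin and
deviation probabilities by a union bound. -/
theorem confinedBound_step {a b x c : Fin d → ℝ} {Z η : ℝ} (ha : ∀ i, 0 < a i)
    (hb : ∀ i, 0 ≤ b i) (hZ : Z = ∑ i, (a i + b i)) (hx : ∀ i, x i * Z = a i - b i)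
    (k : ℕ) {y : Fin d → ℕ} (hy : ∀ i, y i ≠ 0) :
    Z * confinedBound (fun i => b i / a i) x c η (k + 1) y ≤
      ∑ i, (a i * confinedBound (fun i => b i / a i) x c η k (y + Pi.single i 1) +
        b i * confinedBound (fun i => b i / a i) x c η k (y - Pi.single i 1)) := by
  set r : Fin d → ℝ := fun i => b i / a i with hr
  have hle : ∀ i, a i + b i ≤ Z := fun i => by
    rw [hZ]
    exact Finset.single_le_sum (f := fun i => a i + b i)
      (fun j _ => add_nonneg (ha j).le (hb j)) (Finset.mem_univ i)
  have h1 : Z * confinedBound r x c η (k + 1) y = Z * confinedBound r x c η k y -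
      ∑ i, Z * ((2 * (y i + k * x i - c i) * x i + x i ^ 2 + 1) / η ^ 2) := by
    unfold confinedBound
    rw [← Finset.mul_sum, ← mul_sub, sub_sub, ← Finset.sum_add_distrib]
    congr 2
    refine Finset.sum_congr rfl fun i _ => ?_
    push_cast
    ring
  have h2 : ∀ i, (a i * confinedBound r x c η k (y + Pi.single i 1) +
        b i * confinedBound r x c η k (y - Pi.single i 1)) =
      (a i + b i) * confinedBound r x c η k y -
        ((2 * (y i + k * x i - c i) * (x i * Z)) + (a i + b i)) / η ^ 2 := by
    intro i
    rw [confinedBound_update (add_single_ne y i), confinedBound_update (sub_single_ne y i), hx]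
    simp only [Pi.add_apply, Pi.sub_apply, Pi.single_eq_same]
    obtain ⟨m, hm⟩ := Nat.exists_eq_succ_of_ne_zero (hy i)
    rw [hm]
    simp only [Nat.succ_eq_add_one, Nat.add_sub_cancel]
    have hb' : b i = r i * a i := by
      rw [hr]
      field_simp [(ha i).ne']
    rw [hb']
    push_cast
    ring
  simp_rw [h1, h2]
  rw [Finset.sum_sub_distrib, ← Finset.sum_mul, ← hZ]
  refine sub_le_sub_left (Finset.sum_le_sum fun i _ => ?_) _
  rw [← mul_div_assoc]
  refine div_le_div_of_nonneg_right ?_ (sq_nonneg _)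
  have hZ0 : 0 ≤ Z := (add_nonneg (ha i).le (hb i)).trans (hle i)
  -- The second moment (a_i + b_i)/Z of the i-th increment is at most 1 ≤ 1 + x_i².
  nlinarith [hle i, mul_nonneg hZ0 (sq_nonneg (x i))]

/-- Change of measure with density proportional to ∏ a_i^{y_i}. Off the walls the denominator is
exactly d(1+λ), so the tilt is exact there; on the walls nothing has to be proved, as the left side
is nonpositive. -/
theorem reflStep_iterate_ge_confined (hd : 0 < d) (hlam : 0 ≤ lam)
    {a b x c : Fin d → ℝ} {Z η κ : ℝ} (ha : ∀ i, 0 < a i)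
    (hb : ∀ i, 0 ≤ b i) (hab : ∀ i, a i * b i = lam) (hZ : Z = ∑ i, (a i + b i))
    (hx : ∀ i, x i * Z = a i - b i) (hη : 0 < η) (hκ : 0 ≤ κ) {S : Set (Fin d → ℕ)}
    (hS : ∀ y : Fin d → ℕ, (∀ i, |(y i : ℝ) - c i| ≤ η) → y ∈ S ∧ κ * ∏ i, a i ^ y i ≤ 1)
    (k : ℕ) : ∀ y, (Z / (d * (1 + lam))) ^ k * (κ * ∏ i, a i ^ y i) *
      confinedBound (fun i => b i / a i) x c η k y ≤ (reflStep lam)^[k] (S.indicator 1) y := by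
  have hind : ∀ y, 0 ≤ S.indicator (1 : (Fin d → ℕ) → ℝ) y :=
    fun y => Set.indicator_nonneg (fun _ _ => zero_le_one) y
  have hr : ∀ i, 0 ≤ b i / a i := fun i => div_nonneg (hb i) (ha i).le
  have hterm : ∀ (k : ℕ) (y : Fin d → ℕ) i,
      0 ≤ (b i / a i) ^ y i + ((y i + k * x i - c i) ^ 2 + k) / η ^ 2 := fun k y i =>
    add_nonneg (pow_nonneg (hr i) _) (by positivity)
  have hbad : ∀ (k : ℕ) (y : Fin d → ℕ) i,
      1 ≤ (b i / a i) ^ y i + ((y i + k * x i - c i) ^ 2 + k) / η ^ 2 →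
      confinedBound (fun i => b i / a i) x c η k y ≤ 0 := fun k y i h => by
    have := Finset.single_le_sum (fun j _ => hterm k y j) (Finset.mem_univ i)
    unfold confinedBound
    linarith
  have hZ0 : 0 ≤ Z := by
    rw [hZ]
    exact Finset.sum_nonneg fun i _ => add_nonneg (ha i).le (hb i)
  have hE : ∀ y : Fin d → ℕ, 0 ≤ κ * ∏ i, a i ^ y i := fun y =>
    mul_nonneg hκ (Finset.prod_nonneg fun i _ => pow_nonneg (ha i).le _)
  have hD : (0 : ℝ) < d * (1 + lam) := by positivity
  induction k with
  | zero =>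
    intro y
    simp only [pow_zero, one_mul, Function.iterate_zero, id_eq]
    by_cases hbox : ∀ i, |(y i : ℝ) - c i| ≤ η
    · obtain ⟨h1, h2⟩ := hS y hbox
      rw [Set.indicator_of_mem h1, Pi.one_apply]
      have hW : confinedBound (fun i => b i / a i) x c η 0 y ≤ 1 := by
        unfold confinedBound
        linarith [Finset.sum_nonneg fun i (_ : i ∈ Finset.univ) => hterm 0 y i]
      nlinarith [hE y]
    -- Outside the box the quadratic term alone is at least 1, so the bound is nonpositive.
    · push Not at hbox
      obtain ⟨i, hi⟩ := hbox
      refine le_trans (mul_nonpos_of_nonneg_of_nonpos (hE y) (hbad 0 y i ?_)) (hind y)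
      have : 1 ≤ ((y i + ((0 : ℕ) : ℝ) * x i - c i) ^ 2 + ((0 : ℕ) : ℝ)) / η ^ 2 := by
        rw [one_le_div (by positivity)]
        have := sq_le_sq' (by linarith [abs_nonneg ((y i : ℝ) - c i)]) hi.le
        rw [sq_abs] at this
        simpa using this
      linarith [pow_nonneg (hr i) (y i)]
  | succ k ih =>
    intro y
    by_cases hy : ∀ i, y i ≠ 0
    · rw [Function.iterate_succ_apply']
      refine le_trans ?_ (reflStep_mono hlam ih y)
      unfold reflStep
      simp only [hy, if_false]
      have hden : ∑ _i : Fin d, (1 + lam) = d * (1 + lam) := by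
        rw [Finset.sum_const, Finset.card_univ, Fintype.card_fin, nsmul_eq_mul]
      rw [hden, le_div_iff₀ hD]
      have hup : ∀ i, ∏ j, a j ^ (y + Pi.single i 1 : Fin d → ℕ) j = a i * ∏ j, a j ^ y j := fun i => by
        rw [prod_eq_mul_erase (fun j m => a j ^ m) i (add_single_ne y i),
          prod_eq_mul_erase (fun j m => a j ^ m) i (y := y) (z := y) fun _ _ => rfl]
        simp [pow_succ]
        ring
      have hdown : ∀ i, lam * ∏ j, a j ^ (y - Pi.single i 1 : Fin d → ℕ) j = b i * ∏ j, a j ^ y j := fun i => by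
        rw [prod_eq_mul_erase (fun j m => a j ^ m) i (sub_single_ne y i),
          prod_eq_mul_erase (fun j m => a j ^ m) i (y := y) (z := y) fun _ _ => rfl]
        obtain ⟨m, hm⟩ := Nat.exists_eq_succ_of_ne_zero (hy i)
        simp only [Pi.sub_apply, Pi.single_eq_same, hm, Nat.succ_eq_add_one, Nat.add_sub_cancel,
          pow_succ, ← hab i]
        ring
      have hstep := confinedBound_step (c := c) (η := η) ha hb hZ hx k hy
      have hc : 0 ≤ (Z / (d * (1 + lam))) ^ k * (κ * ∏ i, a i ^ y i) :=
        mul_nonneg (by positivity) (hE y)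
      have := mul_le_mul_of_nonneg_left hstep hc
      refine le_trans (le_of_eq ?_) (this.trans (le_of_eq ?_))
      · rw [pow_succ]
        field_simp
      · rw [Finset.mul_sum]
        refine Finset.sum_congr rfl fun i _ => ?_
        rw [hup]
        linear_combination (-((Z / (d * (1 + lam))) ^ k * κ *
          confinedBound (fun i => b i / a i) x c η k (y - Pi.single i 1))) * hdown i
    -- On a wall the ruin term is r_i^0 = 1, so the bound is nonpositive.
    · push Not at hy
      obtain ⟨i, hi⟩ := hy
      refine le_trans (mul_nonpos_of_nonneg_of_nonpos (mul_nonneg (by positivity) (hE y))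
        (hbad _ y i ?_)) (reflStep_iterate_nonneg hlam hind _ y)
      rw [hi, pow_zero]
      have : (0 : ℝ) ≤ (((0 : ℕ) + ((k + 1 : ℕ) : ℝ) * x i - c i) ^ 2 + ((k + 1 : ℕ) : ℝ)) / η ^ 2 := by
        positivity
      linarith

end Operator

/-! ### The function ψ, stationary points, effective domain and zero of Λ*. -/

section RateFunction

/-- The truncation `max (r, s₀)`, written without extended reals. -/
noncomputable def clip (lam r : ℝ) : ℝ :=
  open Classical in if sZero lam ≤ (r : EReal) then r else 1 / 2 * Real.log lam

/-- The right-hand form is uniform in λ: for λ = 0 it always holds, matching s₀ = -∞. -/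
theorem sZero_le_iff {lam : ℝ} (hlam : 0 ≤ lam) (r : ℝ) :
    sZero lam ≤ (r : EReal) ↔ lam * Real.exp (-r) ≤ Real.exp r := by
  unfold sZero
  rcases hlam.eq_or_lt with h | h
  · subst h
    simp [Real.exp_nonneg]
  · rw [if_neg h.ne', EReal.coe_le_coe_iff]
    rw [Real.exp_neg, ← div_eq_mul_inv, div_le_iff₀ (Real.exp_pos r), ← Real.exp_add,
      ← Real.log_le_iff_le_exp h]
    constructor <;> intro h' <;> linarith

theorem exp_half_log {lam : ℝ} (h : 0 < lam) : Real.exp (1 / 2 * Real.log lam) = √lam := by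
  rw [Real.sqrt_eq_rpow, Real.rpow_def_of_pos h, mul_comm]

theorem lam_mul_exp_neg_half_log {lam : ℝ} (h : 0 < lam) :
    lam * Real.exp (-(1 / 2 * Real.log lam)) = √lam := by
  rw [Real.exp_neg, exp_half_log h, ← div_eq_mul_inv, Real.div_sqrt]

theorem pos_of_not_sZero_le {lam r : ℝ} (hlam : 0 ≤ lam) (h : ¬ sZero lam ≤ (r : EReal)) :
    0 < lam := by
  rcases hlam.eq_or_lt with h0 | h0
  · subst h0
    simp [sZero] at h
  · exact h0

theorem clip_eq_self {lam r : ℝ} (hlam : 0 ≤ lam) (h : lam * Real.exp (-r) ≤ Real.exp r) :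
    clip lam r = r := by
  unfold clip
  rw [if_pos ((sZero_le_iff hlam r).2 h)]

theorem le_clip {lam : ℝ} (r : ℝ) : r ≤ clip lam r := by
  unfold clip
  split_ifs with h
  · exact le_rfl
  · unfold sZero at h
    split_ifs at h with h0
    · exact absurd bot_le h
    · rw [EReal.coe_le_coe_iff] at h
      linarith

theorem lam_mul_exp_neg_clip_le {lam : ℝ} (hlam : 0 ≤ lam) (r : ℝ) :
    lam * Real.exp (-clip lam r) ≤ Real.exp (clip lam r) := by
  unfold clip
  split_ifs with h
  · exact (sZero_le_iff hlam r).1 h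
  · have := pos_of_not_sZero_le hlam h
    rw [lam_mul_exp_neg_half_log this, exp_half_log this]

theorem clip_nonpos {lam r : ℝ} (hlam : 0 ≤ lam) (hlam1 : lam ≤ 1) (hr : r ≤ 0) :
    clip lam r ≤ 0 := by
  unfold clip
  split_ifs with h
  · exact hr
  · linarith [Real.log_nonpos hlam hlam1]

variable {d : ℕ} {lam : ℝ}

/-- At s₀ both exponentials equal √λ, and 2√λ = (1+λ)ρ_λ; so the two kinds of summand in ψ are one
expression evaluated at the clipped argument. -/
theorem psi_eq (hlam : 0 ≤ lam) (s : Fin d → ℝ) :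
    psi lam s = (∑ i, (Real.exp (clip lam (s i)) + lam * Real.exp (-clip lam (s i)))) /
      (d * (1 + lam)) := by
  classical
  unfold psi numBelow
  rw [Finset.card_filter, Nat.cast_sum, Finset.sum_mul, Finset.mul_sum, ← Finset.sum_add_distrib,
    Finset.sum_div]
  refine Finset.sum_congr rfl fun i _ => ?_
  by_cases h : sZero lam ≤ (s i : EReal)
  · rw [if_neg (not_lt.2 h), if_pos h, clip, if_pos h]
    push_cast
    ring
  · have h0 := pos_of_not_sZero_le hlam h
    rw [if_pos (not_le.1 h), if_neg h, clip, if_neg h, exp_half_log h0,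
      lam_mul_exp_neg_half_log h0, rhoLam]
    push_cast
    field_simp
    ring

theorem psi_pos (hd : 0 < d) (hlam : 0 ≤ lam) (s : Fin d → ℝ) : 0 < psi lam s := by
  have : Nonempty (Fin d) := ⟨⟨0, hd⟩⟩
  rw [psi_eq hlam]
  refine div_pos (Finset.sum_pos (fun i _ => ?_) Finset.univ_nonempty) (by positivity)
  positivity

theorem psi_mul (hd : 0 < d) (hlam : 0 ≤ lam) (s : Fin d → ℝ) :
    psi lam s * (d * (1 + lam)) =
      ∑ i, (Real.exp (clip lam (s i)) + lam * Real.exp (-clip lam (s i))) := by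
  rw [psi_eq hlam, div_mul_cancel₀]
  positivity

theorem sum_exp_clip_le (hd : 0 < d) (hlam : 0 ≤ lam) (s : Fin d → ℝ) :
    ∑ i, Real.exp (clip lam (s i)) ≤ psi lam s * (d * (1 + lam)) := by
  rw [psi_mul hd hlam]
  exact Finset.sum_le_sum fun i _ => by
    have := mul_nonneg hlam (Real.exp_nonneg (-clip lam (s i)))
    linarith

/-- Tangent line of exp at m. Weighted sums of it, with m the weighted mean, play the role of
Jensen's inequality below. -/
theorem exp_mul_tangent_le (m u : ℝ) : Real.exp m * (1 + u - m) ≤ Real.exp u := by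
  have h := Real.add_one_le_exp (u - m)
  have : Real.exp u = Real.exp m * Real.exp (u - m) := by rw [← Real.exp_add]; ring_nf
  rw [this]
  exact mul_le_mul_of_nonneg_left (by linarith) (Real.exp_nonneg m)

/-- The affine function of `x` whose supremum over `s` is the rate function. -/
noncomputable def tiltValue (lam : ℝ) (s x : Fin d → ℝ) : ℝ :=
  ∑ i, s i * x i - Real.log (psi lam s)

theorem tiltValue_le_rateFn (s x : Fin d → ℝ) : (tiltValue lam s x : EReal) ≤ rateFn lam x :=
  le_iSup (fun s : Fin d → ℝ => ((tiltValue lam s x : ℝ) : EReal)) s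

theorem rateFn_le {x : Fin d → ℝ} {C : EReal} (h : ∀ s, (tiltValue lam s x : EReal) ≤ C) :
    rateFn lam x ≤ C :=
  iSup_le h

theorem exists_lt_tiltValue {x : Fin d → ℝ} {C : EReal} (h : C < rateFn lam x) :
    ∃ s, C < (tiltValue lam s x : EReal) :=
  lt_iSup_iff.1 h

theorem rateFn_eq_top {x : Fin d → ℝ} (h : ∀ C : ℝ, ∃ s, C < tiltValue lam s x) :
    rateFn lam x = ⊤ := by
  rw [EReal.eq_top_iff_forall_lt]
  intro C
  obtain ⟨s, hs⟩ := h C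
  exact lt_of_lt_of_le (EReal.coe_lt_coe_iff.2 hs) (tiltValue_le_rateFn s x)

/-- `s` is a stationary point of `s ↦ (s, x) - ln ψ(s)`. -/
def IsTilt (lam : ℝ) (s x : Fin d → ℝ) : Prop :=
  ∀ i, x i * ∑ j, (Real.exp (s j) + lam * Real.exp (-s j)) =
    Real.exp (s i) - lam * Real.exp (-s i)

/-- When x_i ≥ 0, stationarity forces λe^{-s_i} ≤ e^{s_i}, that is s_i ≥ s₀. -/
theorem IsTilt.clip_eq (hlam : 0 ≤ lam) {s x : Fin d → ℝ} (h : IsTilt lam s x)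
    (hx : ∀ i, 0 ≤ x i) (i : Fin d) : clip lam (s i) = s i := by
  refine clip_eq_self hlam ?_
  have h1 : 0 ≤ ∑ j, (Real.exp (s j) + lam * Real.exp (-s j)) :=
    Finset.sum_nonneg fun j _ => by positivity
  linarith [h i, mul_nonneg (hx i) h1]

theorem IsTilt.psi_mul_eq (hd : 0 < d) (hlam : 0 ≤ lam) {s x : Fin d → ℝ} (h : IsTilt lam s x)
    (hx : ∀ i, 0 ≤ x i) :
    psi lam s * (d * (1 + lam)) = ∑ j, (Real.exp (s j) + lam * Real.exp (-s j)) := by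
  rw [psi_mul hd hlam]
  simp_rw [h.clip_eq hlam hx]

theorem IsTilt.tiltValue_le (hd : 0 < d) (hlam : 0 ≤ lam) {s x : Fin d → ℝ} (h : IsTilt lam s x)
    (hx : ∀ i, 0 ≤ x i) (s' : Fin d → ℝ) : tiltValue lam s' x ≤ tiltValue lam s x := by
  set t : Fin d → ℝ := fun i => clip lam (s' i) with ht
  -- By stationarity, m is the mean of ±(t_i - s_i) under the weights e^{s_i}/Z and λe^{-s_i}/Z;
  -- Jensen then compares ψ(s') with e^m ψ(s).
  set m := ∑ i, (t i - s i) * x i with hm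
  set Z := ∑ j, (Real.exp (s j) + lam * Real.exp (-s j)) with hZ
  have hD : (0 : ℝ) < d * (1 + lam) := by positivity
  have h1 : Real.exp m * psi lam s ≤ psi lam s' := by
    rw [← mul_le_mul_iff_left₀ hD, mul_assoc, h.psi_mul_eq hd hlam hx, psi_mul hd hlam]
    have h2 : Real.exp m * Z = ∑ i, (Real.exp (s i) * (Real.exp m * (1 + (t i - s i) - m)) +
        lam * Real.exp (-s i) * (Real.exp m * (1 + -(t i - s i) - m))) := by
      have : ∀ i, (Real.exp (s i) * (Real.exp m * (1 + (t i - s i) - m)) +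
        lam * Real.exp (-s i) * (Real.exp m * (1 + -(t i - s i) - m))) =
          Real.exp m * (1 - m) * (Real.exp (s i) + lam * Real.exp (-s i)) +
            Real.exp m * Z * ((t i - s i) * x i) := fun i => by
        linear_combination (-Real.exp m * (t i - s i)) * h i
      simp_rw [this]
      rw [Finset.sum_add_distrib, ← Finset.mul_sum, ← Finset.mul_sum, ← hm, ← hZ]
      ring
    rw [h2]
    refine Finset.sum_le_sum fun i _ => add_le_add ?_ ?_
    · refine (mul_le_mul_of_nonneg_left (exp_mul_tangent_le m _) (Real.exp_nonneg _)).trans_eq ?_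
      rw [← Real.exp_add]
      congr 1
      simp [ht]
    · refine (mul_le_mul_of_nonneg_left (exp_mul_tangent_le m _) (by positivity)).trans_eq ?_
      rw [mul_assoc, ← Real.exp_add]
      congr 2
      simp only [ht]
      ring
  have h3 : m + Real.log (psi lam s) ≤ Real.log (psi lam s') := by
    rw [← Real.log_exp m, ← Real.log_mul (Real.exp_ne_zero _) (psi_pos hd hlam s).ne']
    exact Real.log_le_log (mul_pos (Real.exp_pos _) (psi_pos hd hlam s)) h1
  have h4 : ∑ i, s' i * x i ≤ ∑ i, t i * x i :=
    Finset.sum_le_sum fun i _ => mul_le_mul_of_nonneg_right (le_clip _) (hx i)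
  have h5 : m = ∑ i, t i * x i - ∑ i, s i * x i := by
    rw [hm, ← Finset.sum_sub_distrib]
    exact Finset.sum_congr rfl fun i _ => by ring
  unfold tiltValue
  linarith

theorem IsTilt.rateFn_eq (hd : 0 < d) (hlam : 0 ≤ lam) {s x : Fin d → ℝ} (h : IsTilt lam s x)
    (hx : ∀ i, 0 ≤ x i) : rateFn lam x = (tiltValue lam s x : EReal) :=
  le_antisymm (rateFn_le fun s' => EReal.coe_le_coe_iff.2 (h.tiltValue_le hd hlam hx s'))
    (tiltValue_le_rateFn s x)

/-- With T = 1/Z, each stationarity equation is quadratic in e^{s_i}, with positive root (x_i +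
√(x_i² + 4λT²))/(2T). Consistency of Z reduces to the scalar equation ∑ √(x_i² + 4λT²) = 1, solved
by the intermediate value theorem: the left side is ∑ x_i < 1 at T = 0 and at least 1 at T = 1/√λ.
-/
theorem exists_isTilt_of_pos (hd : 0 < d) (hlam : 0 < lam) {x : Fin d → ℝ}
    (hx1 : ∑ i, x i < 1) (hx : ∀ i, 0 ≤ x i) : ∃ s, IsTilt lam s x := by
  have hne : Nonempty (Fin d) := ⟨⟨0, hd⟩⟩
  set g : ℝ → ℝ := fun T => ∑ i, √(x i ^ 2 + 4 * lam * T ^ 2) with hg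
  have hgc : Continuous g := by fun_prop
  have hsl : 0 < √lam := Real.sqrt_pos.2 hlam
  have hg0 : g 0 < 1 := by
    refine lt_of_eq_of_lt ?_ hx1
    refine Finset.sum_congr rfl fun i _ => ?_
    simp [Real.sqrt_sq (hx i)]
  have hg1 : 1 ≤ g (1 / √lam) := by
    have : ∀ i, 1 ≤ √(x i ^ 2 + 4 * lam * (1 / √lam) ^ 2) := fun i => by
      rw [Real.one_le_sqrt, div_pow, Real.sq_sqrt hlam.le]
      have : 4 * lam * (1 ^ 2 / lam) = 4 := by field_simp
      nlinarith [sq_nonneg (x i)]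
    exact (this (Classical.arbitrary _)).trans (Finset.single_le_sum
      (f := fun i => √(x i ^ 2 + 4 * lam * (1 / √lam) ^ 2)) (fun i _ => Real.sqrt_nonneg _)
      (Finset.mem_univ _))
  obtain ⟨T, ⟨hT0, -⟩, hT⟩ := intermediate_value_Icc (by positivity : (0 : ℝ) ≤ 1 / √lam)
    hgc.continuousOn ⟨hg0.le, hg1⟩
  have hTpos : 0 < T := by
    rcases hT0.eq_or_lt with h | h
    · rw [← h] at hT; linarith
    · exact h
  have hw : ∀ i, 0 < √(x i ^ 2 + 4 * lam * T ^ 2) := fun i => Real.sqrt_pos.2 (by positivity)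
  have hu : ∀ i, 0 < (x i + √(x i ^ 2 + 4 * lam * T ^ 2)) / (2 * T) := fun i =>
    div_pos (add_pos_of_nonneg_of_pos (hx i) (hw i)) (by positivity)
  have hinv : ∀ i, lam * ((x i + √(x i ^ 2 + 4 * lam * T ^ 2)) / (2 * T))⁻¹ =
      (√(x i ^ 2 + 4 * lam * T ^ 2) - x i) / (2 * T) := fun i => by
    rw [← div_eq_mul_inv, div_eq_iff (hu i).ne', div_mul_div_comm, eq_div_iff (by positivity)]
    have := Real.sq_sqrt (by positivity : 0 ≤ x i ^ 2 + 4 * lam * T ^ 2)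
    linear_combination -this
  refine ⟨fun i => Real.log ((x i + √(x i ^ 2 + 4 * lam * T ^ 2)) / (2 * T)), fun i => ?_⟩
  simp only [Real.exp_neg, Real.exp_log (hu _), hinv]
  have hsum : ∑ j, ((x j + √(x j ^ 2 + 4 * lam * T ^ 2)) / (2 * T) +
      (√(x j ^ 2 + 4 * lam * T ^ 2) - x j) / (2 * T)) = 1 / T := by
    rw [← hT, hg, Finset.sum_div]
    refine Finset.sum_congr rfl fun j _ => ?_
    field_simp
    ring
  rw [hsum]
  field_simp
  ring

theorem exists_isTilt_zero {x : Fin d → ℝ} (hx1 : ∑ i, x i = 1) (hx : ∀ i, 0 < x i) :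
    ∃ s, IsTilt 0 s x := by
  refine ⟨fun i => Real.log (x i), fun i => ?_⟩
  simp [Real.exp_log (hx _), hx1]

theorem isTilt_zero_mean (hd : 0 < d) (hlam : 0 ≤ lam) :
    IsTilt lam (0 : Fin d → ℝ) fun _ => (1 - lam) / (d * (1 + lam)) := by
  intro i
  simp
  field_simp

theorem psi_zero (hd : 0 < d) (hlam : 0 ≤ lam) (hlam1 : lam ≤ 1) :
    psi lam (0 : Fin d → ℝ) = 1 := by
  rw [psi_eq hlam]
  simp only [Pi.zero_apply, clip_eq_self hlam (r := 0) (by simpa using hlam1)]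
  simp
  field_simp

theorem rateFn_mean (hd : 0 < d) (hlam : 0 ≤ lam) (hlam1 : lam ≤ 1) :
    rateFn lam (fun _ : Fin d => (1 - lam) / (d * (1 + lam))) = 0 := by
  have hx : ∀ _ : Fin d, 0 ≤ (1 - lam) / (d * (1 + lam)) := fun _ =>
    div_nonneg (by linarith) (by positivity)
  rw [(isTilt_zero_mean hd hlam).rateFn_eq hd hlam hx]
  simp [tiltValue, psi_zero hd hlam hlam1]

theorem rateFn_nonneg (hd : 0 < d) (hlam : 0 ≤ lam) (hlam1 : lam ≤ 1) (x : Fin d → ℝ) :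
    0 ≤ rateFn lam x := by
  refine le_trans (le_of_eq ?_) (tiltValue_le_rateFn 0 x)
  simp [tiltValue, psi_zero hd hlam hlam1]

theorem tiltValue_affine (s x x' : Fin d → ℝ) (t : ℝ) :
    tiltValue lam s ((1 - t) • x + t • x') =
      (1 - t) * tiltValue lam s x + t * tiltValue lam s x' := by
  have : ∑ i, s i * ((1 - t) • x + t • x') i =
      (1 - t) * ∑ i, s i * x i + t * ∑ i, s i * x' i := by
    rw [Finset.mul_sum, Finset.mul_sum, ← Finset.sum_add_distrib]
    refine Finset.sum_congr rfl fun i _ => ?_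
    simp
    ring
  unfold tiltValue
  rw [this]
  ring

/-- Convexity of Λ*, as a supremum of affine functions, together with its vanishing at the mean. -/
theorem rateFn_segment_le (hd : 0 < d) (hlam : 0 ≤ lam) (hlam1 : lam ≤ 1) (x : Fin d → ℝ) {t : ℝ}
    (ht0 : 0 ≤ t) (ht1 : t ≤ 1) :
    rateFn lam ((1 - t) • x + t • fun _ => (1 - lam) / (d * (1 + lam))) ≤ rateFn lam x := by
  by_cases htop : rateFn lam x = ⊤
  · rw [htop]; exact le_top
  have hnn := rateFn_nonneg hd hlam hlam1 x
  obtain ⟨c, hc⟩ : ∃ c : ℝ, rateFn lam x = c :=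
    ⟨(rateFn lam x).toReal, (EReal.coe_toReal htop (ne_bot_of_le_ne_bot (by simp) hnn)).symm⟩
  rw [hc] at hnn ⊢
  have hc0 : 0 ≤ c := EReal.coe_nonneg.1 hnn
  refine rateFn_le fun s => ?_
  rw [tiltValue_affine, EReal.coe_le_coe_iff]
  have h1 : tiltValue lam s x ≤ c := EReal.coe_le_coe_iff.1 (hc ▸ tiltValue_le_rateFn s x)
  have h2 : tiltValue lam s (fun _ => (1 - lam) / (d * (1 + lam))) ≤ 0 := by
    have := rateFn_mean hd hlam hlam1 ▸
      tiltValue_le_rateFn s (fun _ : Fin d => (1 - lam) / (d * (1 + lam)))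
    exact_mod_cast this
  nlinarith

theorem rateFn_lowerSemicontinuous : LowerSemicontinuous (rateFn (d := d) lam) := by
  refine lowerSemicontinuous_iSup fun s => Continuous.lowerSemicontinuous ?_
  exact continuous_coe_real_ereal.comp (by fun_prop)

/-- Along s = -K e_i the linear term tends to infinity while clipping keeps ψ at most 2. -/
theorem rateFn_eq_top_of_neg (hd : 0 < d) (hlam : 0 ≤ lam) (hlam1 : lam ≤ 1) {x : Fin d → ℝ}
    {i : Fin d} (hx : x i < 0) : rateFn lam x = ⊤ := by
  refine rateFn_eq_top fun C => ?_
  have hpsi : ∀ s : Fin d → ℝ, (∀ j, s j ≤ 0) → Real.log (psi lam s) ≤ Real.log 2 := by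
    intro s hs
    refine Real.log_le_log (psi_pos hd hlam s) ?_
    rw [psi_eq hlam, div_le_iff₀ (by positivity)]
    have : ∀ j, Real.exp (clip lam (s j)) + lam * Real.exp (-clip lam (s j)) ≤ 2 := fun j => by
      have h1 := Real.exp_le_one_iff.2 (clip_nonpos hlam hlam1 (hs j))
      linarith [lam_mul_exp_neg_clip_le hlam (s j)]
    refine (Finset.sum_le_sum fun j _ => this j).trans ?_
    simp only [Finset.sum_const, Finset.card_univ, Fintype.card_fin, nsmul_eq_mul]
    nlinarith [mul_nonneg (Nat.cast_nonneg (α := ℝ) d) hlam]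
  set K := (|C| + Real.log 2 + 1) / (-x i) with hK
  have hl2 : 0 ≤ Real.log 2 := Real.log_nonneg (by norm_num)
  have hK0 : 0 ≤ K := div_nonneg (by positivity) (by linarith)
  refine ⟨Pi.single i (-K), ?_⟩
  have h1 := hpsi (Pi.single i (-K)) fun j => by
    by_cases hj : j = i
    · subst hj; simpa using hK0
    · simp [hj]
  have h2 : ∑ j, (Pi.single i (-K) : Fin d → ℝ) j * x j = |C| + Real.log 2 + 1 := by
    rw [Finset.sum_eq_single i]
    · simp only [Pi.single_eq_same, hK]
      field_simp [hx.ne]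
    · intro j _ hj
      simp [hj]
    · simp
  unfold tiltValue
  rw [h2]
  linarith [le_abs_self C]

theorem psi_const_le (hd : 0 < d) (hlam : 0 ≤ lam) (hlam1 : lam ≤ 1) {K : ℝ} (hK : 0 ≤ K) :
    psi lam (fun _ : Fin d => K) ≤ Real.exp K := by
  have h1 : Real.exp (-K) ≤ Real.exp K := Real.exp_le_exp.2 (by linarith)
  have h2 : lam * Real.exp (-K) ≤ lam * Real.exp K := mul_le_mul_of_nonneg_left h1 hlam
  have h3 : lam * Real.exp K ≤ Real.exp K := mul_le_of_le_one_left (Real.exp_nonneg K) hlam1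
  rw [psi_eq hlam, div_le_iff₀ (by positivity), clip_eq_self hlam (h2.trans h3)]
  simp only [Finset.sum_const, Finset.card_univ, Fintype.card_fin, nsmul_eq_mul]
  nlinarith [mul_le_mul_of_nonneg_left h2 (Nat.cast_nonneg (α := ℝ) d)]

/-- On the diagonal s = (K, …, K) with K ≥ 0 one has ln ψ ≤ K, so the tilt value is at least K(∑ x_i
- 1). -/
theorem rateFn_eq_top_of_one_lt (hd : 0 < d) (hlam : 0 ≤ lam) (hlam1 : lam ≤ 1) {x : Fin d → ℝ}
    (hx : 1 < ∑ i, x i) : rateFn lam x = ⊤ := by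
  refine rateFn_eq_top fun C => ?_
  set K := (|C| + 1) / (∑ i, x i - 1) with hK
  have hK0 : 0 ≤ K := div_nonneg (by positivity) (by linarith)
  refine ⟨fun _ => K, ?_⟩
  have h1 : Real.log (psi lam fun _ : Fin d => K) ≤ K :=
    (Real.log_le_iff_le_exp (psi_pos hd hlam _)).2 (psi_const_le hd hlam hlam1 hK0)
  have h2 : K * (∑ i, x i - 1) = |C| + 1 := div_mul_cancel₀ _ (by linarith)
  unfold tiltValue
  rw [← Finset.mul_sum]
  linarith [le_abs_self C]

/-- For λ = 0 nothing is clipped and ψ(-K, …, -K) = e^{-K}, so the diagonal can be followed to -∞.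
-/
theorem rateFn_zero_eq_top_of_lt_one (hd : 0 < d) {x : Fin d → ℝ}
    (hx : ∑ i, x i < 1) : rateFn 0 x = ⊤ := by
  refine rateFn_eq_top fun C => ?_
  set K := (|C| + 1) / (1 - ∑ i, x i) with hK
  refine ⟨fun _ => -K, ?_⟩
  have h1 : psi 0 (fun _ : Fin d => -K) = Real.exp (-K) := by
    rw [psi_eq le_rfl, clip_eq_self le_rfl (by simp [Real.exp_nonneg])]
    simp
    field_simp
  have h2 : K * (1 - ∑ i, x i) = |C| + 1 := div_mul_cancel₀ _ (by linarith)
  unfold tiltValue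
  rw [← Finset.mul_sum, h1, Real.log_exp]
  linarith [le_abs_self C]

/-- Jensen with weights x_i on t_i and the remaining mass 1 - ∑ x_i on the exponent 0. That mass
contributes at most 1, which is absorbed since ∑ e^{t_i} ≥ √λ; hence the constant 1 + 1/√λ. -/
theorem rateFn_lt_top (hd : 0 < d) (hlam : 0 < lam) {x : Fin d → ℝ}
    (hx : ∀ i, 0 ≤ x i) (hx1 : ∑ i, x i ≤ 1) : rateFn lam x < ⊤ := by
  have hne : Nonempty (Fin d) := ⟨⟨0, hd⟩⟩
  have hsl : 0 < √lam := Real.sqrt_pos.2 hlam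
  refine lt_of_le_of_lt (rateFn_le (C := ((Real.log ((1 + 1 / √lam) * (d * (1 + lam))) : ℝ) : EReal))
    fun s => ?_) (EReal.coe_lt_top _)
  rw [EReal.coe_le_coe_iff]
  set t : Fin d → ℝ := fun i => clip lam (s i) with ht
  set m := ∑ i, t i * x i with hm
  have h4 : ∑ i, s i * x i ≤ m :=
    Finset.sum_le_sum fun i _ => mul_le_mul_of_nonneg_right (le_clip _) (hx i)
  have h1 : Real.exp m ≤ ∑ i, x i * Real.exp (t i) + (1 - ∑ i, x i) := by
    have e : Real.exp m = ∑ i, x i * (Real.exp m * (1 + t i - m)) +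
        (1 - ∑ i, x i) * (Real.exp m * (1 + 0 - m)) := by
      have : ∀ i, x i * (Real.exp m * (1 + t i - m)) =
          Real.exp m * (1 - m) * x i + Real.exp m * (t i * x i) := fun i => by ring
      simp_rw [this]
      rw [Finset.sum_add_distrib, ← Finset.mul_sum, ← Finset.mul_sum, ← hm]
      ring
    rw [e]
    refine add_le_add (Finset.sum_le_sum fun i _ =>
      mul_le_mul_of_nonneg_left (exp_mul_tangent_le m _) (hx i)) ?_
    refine (mul_le_mul_of_nonneg_left (exp_mul_tangent_le m 0) (by linarith)).trans ?_
    simp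
  have h2 : ∑ i, x i * Real.exp (t i) ≤ ∑ i, Real.exp (t i) :=
    Finset.sum_le_sum fun i _ => mul_le_of_le_one_left (Real.exp_nonneg _)
      ((Finset.single_le_sum (fun j _ => hx j) (Finset.mem_univ i)).trans hx1)
  have h3 : √lam ≤ ∑ i, Real.exp (t i) := by
    refine le_trans ?_ (Finset.single_le_sum (f := fun i => Real.exp (t i))
      (fun i _ => Real.exp_nonneg _) (Finset.mem_univ (Classical.arbitrary (Fin d))))
    have := lam_mul_exp_neg_clip_le hlam.le (s (Classical.arbitrary (Fin d)))
    rw [Real.exp_neg, ← div_eq_mul_inv, div_le_iff₀ (Real.exp_pos _)] at this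
    rw [← Real.sqrt_sq (Real.exp_nonneg (t (Classical.arbitrary (Fin d)))), sq]
    exact Real.sqrt_le_sqrt this
  have h5 := sum_exp_clip_le hd hlam.le s
  have h6 : Real.exp m ≤ (1 + 1 / √lam) * (d * (1 + lam)) * psi lam s := by
    have h7 : 1 ≤ (1 / √lam) * ∑ i, Real.exp (t i) := by
      rw [one_div, inv_mul_eq_div, one_le_div hsl]; exact h3
    have h8 : (1 + 1 / √lam) * ∑ i, Real.exp (t i) ≤
        (1 + 1 / √lam) * (psi lam s * (d * (1 + lam))) :=
      mul_le_mul_of_nonneg_left h5 (by positivity)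
    have h9 : 0 ≤ ∑ i, x i := Finset.sum_nonneg fun i _ => hx i
    linarith
  have h7 : m ≤ Real.log ((1 + 1 / √lam) * (d * (1 + lam))) + Real.log (psi lam s) := by
    rw [← Real.log_mul (by positivity) (psi_pos hd hlam.le s).ne']
    rwa [Real.le_log_iff_exp_le (mul_pos (by positivity) (psi_pos hd hlam.le s))]
  unfold tiltValue
  linarith

/-- Gibbs' variational inequality: Jensen with weights x_i and exponents t_i - ln x_i. -/
theorem rateFn_le_of_sum_eq_one (hd : 0 < d) (hlam : 0 ≤ lam) {x : Fin d → ℝ}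
    (hx : ∀ i, 0 ≤ x i) (hx1 : ∑ i, x i = 1) :
    rateFn lam x ≤ ((Real.log (d * (1 + lam)) + ∑ i, x i * Real.log (x i) : ℝ) : EReal) := by
  refine rateFn_le fun s => ?_
  rw [EReal.coe_le_coe_iff]
  set t : Fin d → ℝ := fun i => clip lam (s i) with ht
  set m := ∑ i, x i * (t i - Real.log (x i)) with hm
  have h4 : ∑ i, s i * x i ≤ ∑ i, t i * x i :=
    Finset.sum_le_sum fun i _ => mul_le_mul_of_nonneg_right (le_clip _) (hx i)
  have h5 : m = ∑ i, t i * x i - ∑ i, x i * Real.log (x i) := by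
    rw [hm, ← Finset.sum_sub_distrib]
    exact Finset.sum_congr rfl fun i _ => by ring
  have h1 : Real.exp m ≤ ∑ i, Real.exp (t i) := by
    have e : Real.exp m = ∑ i, x i * (Real.exp m * (1 + (t i - Real.log (x i)) - m)) := by
      have : ∀ i, x i * (Real.exp m * (1 + (t i - Real.log (x i)) - m)) =
          Real.exp m * (1 - m) * x i + Real.exp m * (x i * (t i - Real.log (x i))) :=
        fun i => by ring
      simp_rw [this]
      rw [Finset.sum_add_distrib, ← Finset.mul_sum, ← Finset.mul_sum, ← hm, hx1]
      ring
    rw [e]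
    refine Finset.sum_le_sum fun i _ => ?_
    rcases (hx i).eq_or_lt with h | h
    · rw [← h]; simp [Real.exp_nonneg]
    · refine (mul_le_mul_of_nonneg_left (exp_mul_tangent_le m _) (hx i)).trans_eq ?_
      rw [Real.exp_sub, Real.exp_log h]
      field_simp
  have h7 : m ≤ Real.log (d * (1 + lam)) + Real.log (psi lam s) := by
    have h0 := psi_pos hd hlam s
    rw [← Real.log_mul (by positivity) h0.ne', Real.le_log_iff_exp_le (mul_pos (by positivity) h0),
      mul_comm]
    exact h1.trans (sum_exp_clip_le hd hlam s)
  unfold tiltValue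
  linarith

theorem rateFn_of_sum_eq_one (hd : 0 < d) (hlam : 0 ≤ lam) (hlam1 : lam ≤ 1) {x : Fin d → ℝ}
    (hx : ∀ i, 0 ≤ x i) (hx1 : ∑ i, x i = 1) :
    rateFn lam x = ((Real.log (d * (1 + lam)) + ∑ i, x i * Real.log (x i) : ℝ) : EReal) := by
  refine le_antisymm (rateFn_le_of_sum_eq_one hd hlam hx hx1) ?_
  have hD : (0 : ℝ) < d * (1 + lam) := by positivity
  -- As K → ∞ these tilts make the λe^{-s_i} terms negligible and approach the Gibbs optimum; the
  -- coordinates with x_i = 0 contribute only (1+λ)e^{-K} after normalisation.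
  let s : ℝ → Fin d → ℝ := fun K i => if x i = 0 then 0 else Real.log (x i) + K
  have hsum : ∀ K, ∑ i, s K i * x i = ∑ i, x i * Real.log (x i) + K := by
    intro K
    have : ∀ i, s K i * x i = x i * Real.log (x i) + K * x i := fun i => by
      by_cases h : x i = 0
      · simp [s, h]
      · simp only [s, h, if_false]; ring
    simp_rw [this]
    rw [Finset.sum_add_distrib, ← Finset.mul_sum, hx1, mul_one]
  have hlim : Tendsto (fun K : ℝ => ∑ i, if x i = 0 then (1 + lam) * Real.exp (-K)
      else x i + lam / x i * Real.exp (-K) ^ 2) atTop (𝓝 1) := by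
    rw [show 𝓝 (1 : ℝ) = 𝓝 (∑ i, x i) by rw [hx1]]
    refine tendsto_finsetSum _ fun i _ => ?_
    have h0 : Tendsto (fun K : ℝ => Real.exp (-K)) atTop (𝓝 0) := Real.tendsto_exp_neg_atTop_nhds_zero
    by_cases h : x i = 0
    · simp only [h, if_true]
      simpa using h0.const_mul (1 + lam)
    · simp only [h, if_false]
      simpa using ((h0.pow 2).const_mul (lam / x i)).const_add (x i)
  have hev : ∀ᶠ K : ℝ in atTop, ∀ i, clip lam (s K i) = s K i := by
    rw [eventually_all]
    intro i
    by_cases h : x i = 0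
    · refine Eventually.of_forall fun K => ?_
      simp only [s, h, if_true]
      exact clip_eq_self hlam (by simpa using hlam1)
    · filter_upwards [eventually_ge_atTop (-Real.log (x i))] with K hK
      simp only [s, h, if_false]
      refine clip_eq_self hlam ?_
      refine (mul_le_of_le_one_left (Real.exp_nonneg _) hlam1).trans ?_
      exact Real.exp_le_exp.2 (by linarith)
  have hval : ∀ᶠ K : ℝ in atTop, tiltValue lam (s K) x =
      Real.log (d * (1 + lam)) + ∑ i, x i * Real.log (x i) -
        Real.log (∑ i, if x i = 0 then (1 + lam) * Real.exp (-K)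
      else x i + lam / x i * Real.exp (-K) ^ 2) := by
    filter_upwards [hev] with K hK
    have h1 : (∑ i, if x i = 0 then (1 + lam) * Real.exp (-K)
        else x i + lam / x i * Real.exp (-K) ^ 2) =
        Real.exp (-K) * (psi lam (s K) * (d * (1 + lam))) := by
      rw [psi_mul hd hlam, Finset.mul_sum]
      refine Finset.sum_congr rfl fun i _ => ?_
      rw [hK i]
      by_cases h : x i = 0
      · simp only [s, h, if_true]
        simp
        ring
      · simp only [s, h, if_false]
        have hxi : 0 < x i := lt_of_le_of_ne (hx i) (Ne.symm h)
        rw [neg_add, Real.exp_add, Real.exp_add, Real.exp_neg (Real.log (x i)), Real.exp_log hxi]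
        have : Real.exp (-K) * Real.exp K = 1 := by rw [← Real.exp_add]; simp
        linear_combination (-x i) * this
    have h0 := psi_pos hd hlam (s K)
    rw [h1, Real.log_mul (Real.exp_ne_zero _) (by positivity), Real.log_mul h0.ne' hD.ne',
      Real.log_exp, tiltValue, hsum]
    ring
  have ht : Tendsto (fun K : ℝ => tiltValue lam (s K) x) atTop
      (𝓝 (Real.log (d * (1 + lam)) + ∑ i, x i * Real.log (x i))) := by
    refine Tendsto.congr' (EventuallyEq.symm hval) ?_
    simpa using ((Real.continuousAt_log one_ne_zero).tendsto.comp hlim).const_sub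
      (Real.log (d * (1 + lam)) + ∑ i, x i * Real.log (x i))
  exact le_of_tendsto ((continuous_coe_real_ereal.tendsto _).comp ht)
    (Eventually.of_forall fun K => tiltValue_le_rateFn (s K) x)

/-- If Λ*(x) = 0, then s·x ≤ ln ψ(s) ≤ ψ(s) - 1 with equality at s = 0; the first-order condition
along each axis determines x_i. Near 0 clipping is inactive because λ < 1. -/
theorem eq_mean_of_rateFn_eq_zero (hd : 0 < d) (hlam : 0 ≤ lam) (hlam1 : lam < 1)
    {x : Fin d → ℝ} (h : rateFn lam x = 0) (i : Fin d) : x i = (1 - lam) / (d * (1 + lam)) := by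
  have hD : (0 : ℝ) < d * (1 + lam) := by positivity
  have hle : ∀ s, ∑ i, s i * x i ≤ Real.log (psi lam s) := fun s => by
    have := h ▸ tiltValue_le_rateFn (lam := lam) s x
    have h' : tiltValue lam s x ≤ 0 := by exact_mod_cast this
    unfold tiltValue at h'
    linarith
  let φ : ℝ → ℝ := fun a => (Real.exp a + lam * Real.exp (-a)) - (1 + lam) - a * x i * (d * (1 + lam))
  have hφ0 : φ 0 = 0 := by simp [φ]
  have hcont : ∀ᶠ a : ℝ in 𝓝 0, lam * Real.exp (-a) ≤ Real.exp a := by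
    have h1 : ContinuousAt (fun a : ℝ => Real.exp a - lam * Real.exp (-a)) 0 := by fun_prop
    have h2 : (0 : ℝ) < Real.exp 0 - lam * Real.exp (-0) := by simpa using hlam1
    filter_upwards [h1.eventually_const_lt h2] with a ha
    linarith
  have hmin : IsLocalMin φ 0 := by
    filter_upwards [hcont] with a ha
    rw [hφ0]
    have h1 := hle (Pi.single i a)
    have h2 : ∑ j, (Pi.single i a : Fin d → ℝ) j * x j = a * x i := by
      rw [Finset.sum_eq_single i]
      · simp
      · intro j _ hj
        simp [hj]
      · simp
    have h3 := Real.log_le_sub_one_of_pos (psi_pos hd hlam (Pi.single i a : Fin d → ℝ))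
    have h4 : psi lam (Pi.single i a : Fin d → ℝ) * (d * (1 + lam)) =
        (Real.exp a + lam * Real.exp (-a)) - (1 + lam) + d * (1 + lam) := by
      rw [psi_mul hd hlam, ← Finset.add_sum_erase _ _ (Finset.mem_univ i)]
      have : ∀ j ∈ Finset.univ.erase i, Real.exp (clip lam ((Pi.single i a : Fin d → ℝ) j)) +
          lam * Real.exp (-clip lam ((Pi.single i a : Fin d → ℝ) j)) = 1 + lam := fun j hj => by
        rw [Pi.single_eq_of_ne (Finset.ne_of_mem_erase hj),
          clip_eq_self hlam (by simpa using hlam1.le)]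
        simp
      rw [Finset.sum_congr rfl this, Pi.single_eq_same, clip_eq_self hlam ha, Finset.sum_const,
        Finset.card_erase_of_mem (Finset.mem_univ i), Finset.card_univ, Fintype.card_fin,
        nsmul_eq_mul, Nat.cast_sub hd]
      push_cast
      ring
    rw [h2] at h1
    have h5 := mul_le_mul_of_nonneg_right (h1.trans h3) hD.le
    simp only [φ]
    linarith
  have hder : HasDerivAt φ ((Real.exp 0 + lam * (Real.exp (-0) * -1)) - 1 * x i * (d * (1 + lam))) 0 := by
    refine HasDerivAt.sub (HasDerivAt.sub_const _ ((Real.hasDerivAt_exp 0).add ?_)) ?_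
    · exact ((hasDerivAt_neg (0 : ℝ)).exp).const_mul lam
    · exact ((hasDerivAt_id (0 : ℝ)).mul_const (x i)).mul_const _
  have := hmin.hasDerivAt_eq_zero hder
  rw [eq_div_iff hD.ne']
  simp at this
  linarith

theorem nonneg_of_rateFn_lt_top (hd : 0 < d) (hlam : 0 ≤ lam) (hlam1 : lam ≤ 1) {x : Fin d → ℝ}
    (h : rateFn lam x < ⊤) : (∀ i, 0 ≤ x i) ∧ ∑ i, x i ≤ 1 := by
  constructor
  · intro i
    by_contra! hc
    exact h.ne (rateFn_eq_top_of_neg hd hlam hlam1 hc)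
  · by_contra! hc
    exact h.ne (rateFn_eq_top_of_one_lt hd hlam hlam1 hc)

theorem isGoodRateFunction_rateFn (hd : 0 < d) (hlam : 0 ≤ lam) (hlam1 : lam ≤ 1) :
    IsGoodRateFunction (rateFn (d := d) lam) where
  nonneg := rateFn_nonneg hd hlam hlam1
  lowerSemicontinuous := rateFn_lowerSemicontinuous
  isCompact_sublevel a := by
    refine IsCompact.of_isClosed_subset (isCompact_Icc (a := (0 : Fin d → ℝ)) (b := 1))
      (rateFn_lowerSemicontinuous.isClosed_preimage _) fun x hx => ?_
    obtain ⟨h1, h2⟩ := nonneg_of_rateFn_lt_top hd hlam hlam1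
      (lt_of_le_of_lt hx (EReal.coe_lt_top a))
    exact ⟨h1, fun i => (Finset.single_le_sum (fun j _ => h1 j) (Finset.mem_univ i)).trans h2⟩

end RateFunction

/-! ### The large deviation bounds. -/

section LDP

variable {d : ℕ} {lam : ℝ}

/-- Exponential Chebyshev: on S the product supersolution dominates e^{s·y}, hence a multiple of the
indicator. The start enters only through a factor free of n. -/
theorem reflStep_iterate_indicator_le (hd : 0 < d) (hlam : 0 ≤ lam) (hlam1 : lam ≤ 1)
    (s : Fin d → ℝ) {a : ℝ} {n : ℕ} (hn : 0 < n) {S : Set (Fin d → ℕ)}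
    (hS : ∀ y ∈ S, a ≤ tiltValue lam s fun i => (y i : ℝ) / n) (y₀ : Fin d → ℕ) :
    (reflStep lam)^[n] (S.indicator 1) y₀ ≤ Real.exp (-(n * a)) *
      ∏ i, (Real.exp (clip lam (s i)) ^ y₀ i + (lam * Real.exp (-clip lam (s i))) ^ y₀ i) := by
  have hψ := psi_pos hd hlam s
  have hnr : (0 : ℝ) < n := Nat.cast_pos.2 hn
  have hb : ∀ i, 0 ≤ lam * Real.exp (-clip lam (s i)) := fun i => by positivity
  have hf := reflStep_prod_le hd hlam hlam1 (a := fun i => Real.exp (clip lam (s i)))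
    (b := fun i => lam * Real.exp (-clip lam (s i))) (fun i => (Real.exp_pos _).le) hb
    (fun i => by rw [mul_left_comm, ← Real.exp_add]; simp)
  rw [← psi_eq hlam] at hf
  refine (reflStep_iterate_le hlam (C := Real.exp (-(n * (Real.log (psi lam s) + a))))
    (Real.exp_nonneg _) hψ.le ?_ hf n y₀).trans_eq ?_
  · intro y
    have hprod : 0 ≤ ∏ i, (Real.exp (clip lam (s i)) ^ y i +
        (lam * Real.exp (-clip lam (s i))) ^ y i) :=
      Finset.prod_nonneg fun i _ => add_nonneg (by positivity) (pow_nonneg (hb i) _)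
    by_cases hy : y ∈ S
    · rw [Set.indicator_of_mem hy, Pi.one_apply]
      have h1 : Real.exp (∑ i, s i * y i) ≤ ∏ i, (Real.exp (clip lam (s i)) ^ y i +
          (lam * Real.exp (-clip lam (s i))) ^ y i) := by
        rw [Real.exp_sum]
        refine Finset.prod_le_prod (fun i _ => Real.exp_nonneg _) fun i _ => ?_
        rw [← Real.exp_nat_mul]
        refine le_trans (Real.exp_le_exp.2 ?_) (le_add_of_nonneg_right (pow_nonneg (hb i) _))
        rw [mul_comm]
        exact mul_le_mul_of_nonneg_left (le_clip _) (Nat.cast_nonneg _)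
      refine le_trans ?_ (mul_le_mul_of_nonneg_left h1 (Real.exp_nonneg _))
      rw [← Real.exp_add, Real.one_le_exp_iff]
      have h2 := mul_le_mul_of_nonneg_left (hS y hy) hnr.le
      have h3 : n * ∑ i, s i * ((y i : ℝ) / n) = ∑ i, s i * y i := by
        rw [Finset.mul_sum]
        refine Finset.sum_congr rfl fun i _ => ?_
        field_simp
      unfold tiltValue at h2
      rw [mul_sub, h3] at h2
      linarith
    · rw [Set.indicator_of_notMem hy]
      exact mul_nonneg (Real.exp_nonneg _) hprod
  · congr 1
    have : psi lam s ^ n = Real.exp (n * Real.log (psi lam s)) := by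
      rw [Real.exp_nat_mul, Real.exp_log hψ]
    rw [this, ← Real.exp_add]
    congr 1
    ring

theorem exists_finset_tiltValue_gt {F : Set (Fin d → ℝ)}
    (hF : IsClosed F) {a : ℝ} (ha : (a : EReal) < ⨅ x ∈ F, rateFn lam x) :
    ∃ T : Finset (Fin d → ℝ), ∀ x ∈ F, (∀ i, 0 ≤ x i) → ∃ s ∈ T, a < tiltValue lam s x := by
  classical
  have hcont : ∀ s : Fin d → ℝ, Continuous fun x => tiltValue lam s x := fun s => by
    unfold tiltValue
    fun_prop
  have hex : ∀ x ∈ F, ∃ s, a < tiltValue lam s x := fun x hx => by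
    obtain ⟨s, hs⟩ := exists_lt_tiltValue (ha.trans_le (iInf₂_le x hx))
    exact ⟨s, EReal.coe_lt_coe_iff.1 hs⟩
  choose! σ hσ using hex
  -- Beyond the cube of side L some x_i > L, and there the single tilt e_i already exceeds a;
  -- compactness is needed only inside the cube.
  set L : ℝ := |a| + ∑ i, |Real.log (psi lam (Pi.single i 1 : Fin d → ℝ))| + 1 with hL
  have hK : IsCompact (F ∩ Icc 0 fun _ => L) := isCompact_Icc.inter_left hF
  obtain ⟨T, hTF, hT⟩ := hK.elim_nhds_subcover (fun x => {z | a < tiltValue lam (σ x) z})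
    fun x hx => (isOpen_lt continuous_const (hcont _)).mem_nhds (hσ x hx.1)
  refine ⟨T.image σ ∪ Finset.univ.image fun i => Pi.single i 1, fun x hx hx0 => ?_⟩
  by_cases hb : ∀ i, x i ≤ L
  · have := hT ⟨hx, hx0, hb⟩
    simp only [mem_iUnion] at this
    obtain ⟨z, hz, hxz⟩ := this
    exact ⟨σ z, Finset.mem_union_left _ (Finset.mem_image_of_mem _ hz), hxz⟩
  · push Not at hb
    obtain ⟨i, hi⟩ := hb
    refine ⟨Pi.single i 1, Finset.mem_union_right _ (Finset.mem_image_of_mem _ (Finset.mem_univ i)),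
      ?_⟩
    have h1 : ∑ j, (Pi.single i 1 : Fin d → ℝ) j * x j = x i := by
      rw [Finset.sum_eq_single i]
      · simp
      · intro j _ hj
        simp [hj]
      · simp
    have h2 := Finset.single_le_sum
      (f := fun i => |Real.log (psi lam (Pi.single i 1 : Fin d → ℝ))|)
      (fun j _ => abs_nonneg _) (Finset.mem_univ i)
    unfold tiltValue
    rw [h1]
    linarith [le_abs_self a, le_abs_self (Real.log (psi lam (Pi.single i 1 : Fin d → ℝ)))]

theorem inv_mul_log_ofReal_exp {n : ℕ} (b : ℝ) :
    (((n : ℝ)⁻¹ : ℝ) : EReal) * ENNReal.log (ENNReal.ofReal (Real.exp b)) =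
      ((b / n : ℝ) : EReal) := by
  rw [ENNReal.log_ofReal_of_pos (Real.exp_pos b), Real.log_exp, ← EReal.coe_mul, inv_mul_eq_div]

theorem inv_mul_log_mono {n : ℕ} {p q : ENNReal} (h : p ≤ q) :
    (((n : ℝ)⁻¹ : ℝ) : EReal) * ENNReal.log p ≤ (((n : ℝ)⁻¹ : ℝ) : EReal) * ENNReal.log q :=
  mul_le_mul_of_nonneg_left (ENNReal.log_monotone h) (EReal.coe_nonneg.2 (by positivity))

theorem tendsto_coe_affine_div (C v : ℝ) :
    Tendsto (fun n : ℕ => (((C + n * v) / n : ℝ) : EReal)) atTop (𝓝 (v : EReal)) := by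
  refine (continuous_coe_real_ereal.tendsto v).comp ?_
  have h : Tendsto (fun n : ℕ => C / (n : ℝ) + v) atTop (𝓝 (0 + v)) :=
    (tendsto_const_div_atTop_nhds_zero_nat C).add_const v
  rw [zero_add] at h
  refine h.congr' ?_
  filter_upwards [eventually_gt_atTop 0] with n hn
  have : (n : ℝ) ≠ 0 := Nat.cast_ne_zero.2 hn.ne'
  field_simp

/-- A bounded number m of outward steps brings the walk to depth M; the remaining n - m steps are
tilted. Both the m steps and the starting point affect only the constant C. -/
theorem exists_reflStep_iterate_ge (hd : 0 < d) (hlam : 0 ≤ lam) (hlam1 : lam ≤ 1)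
    {s x : Fin d → ℝ} (h : IsTilt lam s x) (hx : ∀ i, 0 < x i) (y₀ : Fin d → ℕ) {δ : ℝ}
    (hδ : 0 < δ) : ∃ C : ℝ, ∀ᶠ n : ℕ in atTop, ∀ S : Set (Fin d → ℕ),
      (∀ y : Fin d → ℕ, (∀ i, |(y i : ℝ) - n * x i| ≤ n * δ) → y ∈ S) →
      Real.exp (C + n * (-tiltValue lam s x - δ * ∑ i, |s i|)) ≤
        (reflStep lam)^[n] (S.indicator 1) y₀ := by
  have hne : Nonempty (Fin d) := ⟨⟨0, hd⟩⟩
  have hdr : (0 : ℝ) < d := Nat.cast_pos.2 hd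
  have hψ := psi_pos hd hlam s
  set a : Fin d → ℝ := fun i => Real.exp (s i) with ha
  set b : Fin d → ℝ := fun i => lam * Real.exp (-s i) with hb
  set Z := ∑ i, (a i + b i) with hZ
  have ha0 : ∀ i, 0 < a i := fun i => Real.exp_pos _
  have hb0 : ∀ i, 0 ≤ b i := fun i => by positivity
  have hab : ∀ i, a i * b i = lam := fun i => by
    rw [ha, hb]
    simp only
    rw [mul_left_comm, ← Real.exp_add]
    simp
  have hZ0 : 0 < Z := Finset.sum_pos (fun i _ => add_pos_of_pos_of_nonneg (ha0 i) (hb0 i))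
    Finset.univ_nonempty
  have hψZ : Z / (d * (1 + lam)) = psi lam s := by
    rw [div_eq_iff (by positivity), h.psi_mul_eq hd hlam fun i => (hx i).le]
  have hr1 : ∀ i, b i / a i < 1 := fun i => by
    rw [div_lt_one (ha0 i)]
    have := mul_pos (hx i) hZ0
    linarith [h i]
  -- At depth M the ruin terms of the d coordinates total at most 1/4; the deviation terms take
  -- another 1/4 for large n, leaving 1/2.
  obtain ⟨M, hM⟩ : ∃ M : ℕ, ∀ i, (b i / a i) ^ M ≤ 1 / (4 * d) := by
    have : ∀ᶠ M : ℕ in atTop, ∀ i, (b i / a i) ^ M ≤ 1 / (4 * (d : ℝ)) := by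
      rw [eventually_all]
      intro i
      exact (tendsto_pow_atTop_nhds_zero_of_lt_one (div_nonneg (hb0 i) (ha0 i).le)
        (hr1 i)).eventually_le_const (by positivity)
    exact this.exists
  set z : Fin d → ℕ := fun _ => M with hz
  set m := ∑ i, z i with hm
  set A := ∏ i, a i ^ (y₀ + z) i with hA
  have hA0 : 0 < A := Finset.prod_pos fun i _ => pow_pos (ha0 i) _
  have hconf : ∀ᶠ n : ℕ in atTop, ∀ k : ℕ, n = k + m →
      1 / 2 ≤ confinedBound (fun i => b i / a i) x (fun i => n * x i) (n * δ) k (y₀ + z) := by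
    have hlim : Tendsto (fun n : ℕ => ∑ i, (((y₀ i + M - m * x i) ^ 2 / δ ^ 2) / (n : ℝ) / n +
        (1 / δ ^ 2) / (n : ℝ))) atTop (𝓝 0) := by
      rw [← Finset.sum_const_zero (s := (Finset.univ : Finset (Fin d)))]
      refine tendsto_finsetSum _ fun i _ => ?_
      have h1 := tendsto_const_div_atTop_nhds_zero_nat ((y₀ i + M - m * x i) ^ 2 / δ ^ 2)
      have h2 := tendsto_const_div_atTop_nhds_zero_nat (1 / δ ^ 2 : ℝ)
      simpa using (h1.div_atTop tendsto_natCast_atTop_atTop).add h2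
    filter_upwards [hlim.eventually_le_const (by norm_num : (0 : ℝ) < 1 / 4),
      eventually_gt_atTop 0] with n hn hn0 k hk
    have hnr : (0 : ℝ) < n := Nat.cast_pos.2 hn0
    have hkn : (n : ℝ) = k + m := by rw [hk]; push_cast; ring
    have h1 : ∑ i, (b i / a i) ^ (y₀ + z) i ≤ 1 / 4 := by
      have : ∀ i, (b i / a i) ^ (y₀ + z) i ≤ 1 / (4 * d) := fun i => by
        refine le_trans ?_ (hM i)
        exact pow_le_pow_of_le_one (div_nonneg (hb0 i) (ha0 i).le) (hr1 i).le (by simp [hz])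
      refine (Finset.sum_le_sum fun i _ => this i).trans_eq ?_
      simp only [Finset.sum_const, Finset.card_univ, Fintype.card_fin, nsmul_eq_mul]
      field_simp
    have h2 : ∑ i, ((((y₀ + z) i : ℕ) + k * x i - n * x i) ^ 2 + (k : ℝ)) / (n * δ) ^ 2 ≤ 1 / 4 := by
      refine le_trans (Finset.sum_le_sum fun i _ => ?_) hn
      have e : ((((y₀ + z) i : ℕ) : ℝ) + k * x i - n * x i) = y₀ i + M - m * x i := by
        rw [hkn]
        simp only [Pi.add_apply, hz]
        push_cast
        ring
      have hk' : (k : ℝ) ≤ n := by rw [hkn]; linarith [Nat.cast_nonneg (α := ℝ) m]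
      rw [e, add_div]
      refine add_le_add (le_of_eq ?_) ((div_le_div_of_nonneg_right hk' (sq_nonneg _)).trans_eq ?_)
      · field_simp
      · field_simp
    unfold confinedBound
    rw [Finset.sum_add_distrib]
    linarith
  refine ⟨Real.log ((1 / (2 * d)) ^ m * A * (1 / 2)) - m * Real.log (psi lam s), ?_⟩
  filter_upwards [hconf, eventually_ge_atTop m, eventually_gt_atTop 0] with n hn hnm hn0 S hS
  have hnr : (0 : ℝ) < n := Nat.cast_pos.2 hn0
  obtain ⟨k, hk⟩ : ∃ k, n = k + m := ⟨n - m, by omega⟩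
  -- κ is the reciprocal of an upper bound for ∏ a_i^{y_i} = e^{s·y} on the box of half-width nδ
  -- around nx.
  set κ := Real.exp (-(n * (∑ i, s i * x i + δ * ∑ i, |s i|))) with hκ
  have hbox : ∀ y : Fin d → ℕ, (∀ i, |(y i : ℝ) - n * x i| ≤ n * δ) →
      y ∈ S ∧ κ * ∏ i, a i ^ y i ≤ 1 := by
    intro y hy
    refine ⟨hS y hy, ?_⟩
    have e : ∏ i, a i ^ y i = Real.exp (∑ i, s i * y i) := by
      rw [Real.exp_sum]
      refine Finset.prod_congr rfl fun i _ => ?_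
      rw [ha, ← Real.exp_nat_mul, mul_comm]
    rw [e, hκ, ← Real.exp_add, Real.exp_le_one_iff]
    have : ∑ i, s i * y i ≤ ∑ i, (n * (s i * x i) + n * δ * |s i|) := by
      refine Finset.sum_le_sum fun i _ => ?_
      have h1 : s i * ((y i : ℝ) - n * x i) ≤ |s i| * (n * δ) := by
        refine (le_abs_self _).trans ?_
        rw [abs_mul]
        exact mul_le_mul_of_nonneg_left (hy i) (abs_nonneg _)
      linarith
    rw [Finset.sum_add_distrib, ← Finset.mul_sum, ← Finset.mul_sum] at this
    linarith
  have hind : ∀ y, 0 ≤ S.indicator (1 : (Fin d → ℕ) → ℝ) y :=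
    fun y => Set.indicator_nonneg (fun _ _ => zero_le_one) y
  have h1 := reflStep_iterate_ge_confined hd hlam ha0 hb0 hab hZ h (by positivity : 0 < n * δ)
    (Real.exp_nonneg _) hbox k (y₀ + z)
  rw [hψZ] at h1
  have h2 := reflStep_iterate_ge_up hd hlam hlam1 y₀ z _ (reflStep_iterate_nonneg hlam hind k)
  rw [← Function.iterate_add_apply, ← hm, add_comm m k, ← hk] at h2
  refine le_trans ?_ ((mul_le_mul_of_nonneg_left (le_trans (mul_le_mul_of_nonneg_left (hn k hk)
    (by positivity)) h1) (by positivity)).trans h2)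
  have hpk : psi lam s ^ k = Real.exp (k * Real.log (psi lam s)) := by
    rw [Real.exp_nat_mul, Real.exp_log hψ]
  have hconst : (0 : ℝ) < (1 / (2 * d)) ^ m * A * (1 / 2) := by positivity
  rw [hpk]
  have e : (1 / (2 * (d : ℝ))) ^ m * (Real.exp (k * Real.log (psi lam s)) * (κ * A) * (1 / 2)) =
      Real.exp (Real.log ((1 / (2 * d)) ^ m * A * (1 / 2))) *
        (Real.exp (k * Real.log (psi lam s)) * κ) := by
    rw [Real.exp_log hconst]
    ring
  rw [e, hκ, ← Real.exp_add, ← Real.exp_add]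
  refine Real.exp_le_exp.2 (le_of_eq ?_)
  have hkn : (n : ℝ) = k + m := by rw [hk]; push_cast; ring
  unfold tiltValue
  rw [hkn]
  ring

/-- Mixing in the mean makes all coordinates positive. For λ > 0 it also pushes the sum below 1; for
λ = 0 the sum stays 1, which is where stationary points then live. -/
theorem exists_isTilt_of_segment (hd : 0 < d) (hlam : 0 ≤ lam) (hlam1 : lam < 1) {x : Fin d → ℝ}
    (hx : rateFn lam x < ⊤) {t : ℝ} (ht0 : 0 < t) (ht1 : t ≤ 1) :
    (∀ i, 0 < ((1 - t) • x + t • fun _ => (1 - lam) / (d * (1 + lam)) : Fin d → ℝ) i) ∧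
    ∃ s, IsTilt lam s ((1 - t) • x + t • fun _ => (1 - lam) / (d * (1 + lam))) := by
  have hdr : (0 : ℝ) < d := Nat.cast_pos.2 hd
  obtain ⟨h0, h1⟩ := nonneg_of_rateFn_lt_top hd hlam hlam1.le hx
  have hpos : ∀ i, 0 < ((1 - t) • x + t • fun _ => (1 - lam) / (d * (1 + lam)) : Fin d → ℝ) i := by
    intro i
    simp only [Pi.add_apply, Pi.smul_apply, smul_eq_mul]
    have : 0 < t * ((1 - lam) / (d * (1 + lam))) :=
      mul_pos ht0 (div_pos (by linarith) (by positivity))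
    have := mul_nonneg (by linarith : 0 ≤ 1 - t) (h0 i)
    linarith
  have hsum : ∑ i, ((1 - t) • x + t • fun _ => (1 - lam) / (d * (1 + lam)) : Fin d → ℝ) i =
      (1 - t) * ∑ i, x i + t * ((1 - lam) / (1 + lam)) := by
    simp only [Pi.add_apply, Pi.smul_apply, smul_eq_mul, Finset.sum_add_distrib, ← Finset.mul_sum,
      Finset.sum_const, Finset.card_univ, Fintype.card_fin, nsmul_eq_mul]
    field_simp
  refine ⟨hpos, ?_⟩
  rcases hlam.eq_or_lt with hl | hl
  · subst hl
    refine exists_isTilt_zero ?_ hpos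
    have : ∑ i, x i = 1 := by
      by_contra hne
      exact hx.ne (rateFn_zero_eq_top_of_lt_one hd (lt_of_le_of_ne h1 hne))
    rw [hsum, this]
    ring
  · refine exists_isTilt_of_pos hd hl ?_ fun i => (hpos i).le
    rw [hsum]
    have h2 : (1 - lam) / (1 + lam) < 1 := by rw [div_lt_one (by linarith)]; linarith
    nlinarith

variable {Ω : Type*} [MeasurableSpace Ω] {P : Measure Ω} [IsProbabilityMeasure P]
  {x₀ : Fin d → ℤ} {X : ℕ → Ω → (Fin d → ℤ)}

theorem IsBiasedRW.ldp_upper (h : IsBiasedRW P lam x₀ X) (hd : 0 < d) (hlam : 0 ≤ lam)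
    (hlam1 : lam ≤ 1) {F : Set (Fin d → ℝ)} (hF : IsClosed F) :
    limsup (fun n : ℕ => (((n : ℝ)⁻¹ : ℝ) : EReal) *
      ENNReal.log (P.map (scaledReflected X n) F)) atTop ≤ -(⨅ x ∈ F, rateFn lam x) := by
  rw [EReal.le_neg]
  refine EReal.ge_of_forall_gt_iff_ge.1 fun a ha => ?_
  rw [EReal.le_neg]
  obtain ⟨T, hT⟩ := exists_finset_tiltValue_gt hF ha
  set c : (Fin d → ℝ) → ℝ := fun s => ∏ i, (Real.exp (clip lam (s i)) ^ latticeAbs x₀ i +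
    (lam * Real.exp (-clip lam (s i))) ^ latticeAbs x₀ i) with hc
  have hc0 : ∀ s, 0 ≤ c s := fun s => Finset.prod_nonneg fun i _ => by positivity
  -- The added 1 keeps the logarithm meaningful when T is empty.
  have hC0 : 0 < ∑ s ∈ T, c s + 1 := by
    have := Finset.sum_nonneg fun s (_ : s ∈ T) => hc0 s
    linarith
  have hcont : ∀ s : Fin d → ℝ, Continuous fun x => tiltValue lam s x := fun s => by
    unfold tiltValue
    fun_prop
  have hV : ∀ s, MeasurableSet {x : Fin d → ℝ | a < tiltValue lam s x} := fun s =>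
    (isOpen_lt continuous_const (hcont s)).measurableSet
  have hbound : ∀ n : ℕ, 0 < n → P.map (scaledReflected X n) F ≤
      ENNReal.ofReal (Real.exp (Real.log (∑ s ∈ T, c s + 1) + n * -a)) := by
    intro n hn
    have hm := h.measurable_scaledReflected n
    calc P.map (scaledReflected X n) F
        ≤ P.map (scaledReflected X n) (⋃ s ∈ T, {x | a < tiltValue lam s x}) := by
          rw [Measure.map_apply hm hF.measurableSet,
            Measure.map_apply hm (Finset.measurableSet_biUnion T fun s _ => hV s)]
          refine measure_mono fun ω hω => ?_
          obtain ⟨s, hs, hsa⟩ := hT _ hω fun i => by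
            rw [scaledReflected_eq]
            positivity
          exact mem_biUnion hs hsa
      _ ≤ ∑ s ∈ T, P.map (scaledReflected X n) {x | a < tiltValue lam s x} :=
          measure_biUnion_finset_le _ _
      _ ≤ ∑ s ∈ T, ENNReal.ofReal (Real.exp (-(n * a)) * c s) := by
          refine Finset.sum_le_sum fun s _ => ?_
          rw [h.map_scaledReflected hlam n (hV s)]
          exact ENNReal.ofReal_le_ofReal (reflStep_iterate_indicator_le hd hlam hlam1 s hn
            (fun y hy => le_of_lt hy) _)
      _ = ENNReal.ofReal (Real.exp (-(n * a)) * ∑ s ∈ T, c s) := by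
          rw [Finset.mul_sum, ENNReal.ofReal_sum_of_nonneg]
          exact fun s _ => mul_nonneg (Real.exp_nonneg _) (hc0 s)
      _ ≤ _ := by
          refine ENNReal.ofReal_le_ofReal ?_
          rw [Real.exp_add, Real.exp_log hC0, mul_comm, mul_neg]
          exact mul_le_mul_of_nonneg_right (by linarith) (Real.exp_nonneg _)
  have hlim := tendsto_coe_affine_div (Real.log (∑ s ∈ T, c s + 1)) (-a)
  rw [← EReal.coe_neg, ← hlim.limsup_eq]
  refine limsup_le_limsup ?_
  filter_upwards [eventually_gt_atTop 0] with n hn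
  rw [← inv_mul_log_ofReal_exp]
  exact inv_mul_log_mono (hbound n hn)

theorem IsBiasedRW.le_liminf_of_isTilt (h : IsBiasedRW P lam x₀ X) (hd : 0 < d) (hlam : 0 ≤ lam)
    (hlam1 : lam ≤ 1) {G : Set (Fin d → ℝ)} (hG : IsOpen G) {s x : Fin d → ℝ}
    (hs : IsTilt lam s x) (hx : ∀ i, 0 < x i) (hxG : x ∈ G) :
    ((-tiltValue lam s x : ℝ) : EReal) ≤ liminf (fun n : ℕ => (((n : ℝ)⁻¹ : ℝ) : EReal) *
      ENNReal.log (P.map (scaledReflected X n) G)) atTop := by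
  refine EReal.ge_of_forall_gt_iff_ge.1 fun v hv => ?_
  rw [EReal.coe_lt_coe_iff] at hv
  obtain ⟨ε, hε, hball⟩ := Metric.isOpen_iff.1 hG x hxG
  have hσ : 0 ≤ ∑ i, |s i| := Finset.sum_nonneg fun i _ => abs_nonneg _
  obtain ⟨δ, hδ, hδε, hδv⟩ : ∃ δ : ℝ, 0 < δ ∧ δ < ε ∧
      v ≤ -tiltValue lam s x - δ * ∑ i, |s i| := by
    refine ⟨min (ε / 2) ((-tiltValue lam s x - v) / (∑ i, |s i| + 1)),
      lt_min (by linarith) (div_pos (by linarith) (by linarith)),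
      (min_le_left _ _).trans_lt (by linarith), ?_⟩
    have h1 := mul_le_mul_of_nonneg_right (min_le_right (ε / 2)
      ((-tiltValue lam s x - v) / (∑ i, |s i| + 1))) hσ
    have h2 : (-tiltValue lam s x - v) / (∑ i, |s i| + 1) * ∑ i, |s i| ≤
        -tiltValue lam s x - v := by
      rw [div_mul_eq_mul_div, div_le_iff₀ (by linarith)]
      nlinarith
    linarith
  obtain ⟨C, hC⟩ := exists_reflStep_iterate_ge hd hlam hlam1 hs hx (latticeAbs x₀) hδ
  have hlim := tendsto_coe_affine_div C (-tiltValue lam s x - δ * ∑ i, |s i|)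
  refine (EReal.coe_le_coe_iff.2 hδv).trans ?_
  rw [← hlim.liminf_eq]
  refine liminf_le_liminf ?_
  filter_upwards [hC, eventually_gt_atTop 0] with n hn hn0
  have hnr : (0 : ℝ) < n := Nat.cast_pos.2 hn0
  rw [← inv_mul_log_ofReal_exp]
  refine inv_mul_log_mono ?_
  rw [h.map_scaledReflected hlam n hG.measurableSet]
  refine ENNReal.ofReal_le_ofReal (hn _ fun y hy => hball ?_)
  refine lt_of_le_of_lt ((dist_pi_le_iff hδ.le).2 fun i => ?_) hδε
  rw [Real.dist_eq]
  have e : (y i : ℝ) / n - x i = (y i - n * x i) / n := by field_simp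
  rw [e, abs_div, abs_of_pos hnr, div_le_iff₀ hnr, mul_comm δ]
  exact hy i

theorem IsBiasedRW.ldp_lower (h : IsBiasedRW P lam x₀ X) (hd : 0 < d) (hlam : 0 ≤ lam)
    (hlam1 : lam < 1) {G : Set (Fin d → ℝ)} (hG : IsOpen G) :
    -(⨅ x ∈ G, rateFn lam x) ≤ liminf (fun n : ℕ => (((n : ℝ)⁻¹ : ℝ) : EReal) *
      ENNReal.log (P.map (scaledReflected X n) G)) atTop := by
  rw [EReal.neg_le]
  refine le_iInf₂ fun x hxG => ?_
  rw [EReal.neg_le]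
  by_cases htop : rateFn lam x = ⊤
  · rw [htop]; simp
  have hc : Continuous fun t : ℝ =>
      ((1 - t) • x + t • fun _ => (1 - lam) / (d * (1 + lam)) : Fin d → ℝ) := by fun_prop
  have hev : ∀ᶠ t : ℝ in 𝓝[>] 0,
      ((1 - t) • x + t • fun _ => (1 - lam) / (d * (1 + lam)) : Fin d → ℝ) ∈ G :=
    (hc.tendsto 0).mono_left nhdsWithin_le_nhds (hG.mem_nhds (by simpa using hxG))
  -- One small t > 0 is enough: the rate does not increase along the segment, so no limit t → 0 is
  -- taken.
  obtain ⟨t, htG, ht0, ht1⟩ := (hev.and (Ioc_mem_nhdsGT (zero_lt_one (α := ℝ)))).exists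
  obtain ⟨hpos, s, hs⟩ := exists_isTilt_of_segment hd hlam hlam1 (lt_top_iff_ne_top.2 htop) ht0 ht1
  refine le_trans ?_ (h.le_liminf_of_isTilt hd hlam hlam1.le hG hs hpos htG)
  rw [EReal.coe_neg, EReal.neg_le_neg_iff]
  exact (tiltValue_le_rateFn s _).trans (rateFn_segment_le hd hlam hlam1.le x ht0.le ht1)

theorem IsBiasedRW.satisfiesLDP (h : IsBiasedRW P lam x₀ X) (hd : 0 < d) (hlam : 0 ≤ lam)
    (hlam1 : lam < 1) :
    SatisfiesLDP (fun n => P.map (scaledReflected X n)) (rateFn (d := d) lam) where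
  upper _ hF := h.ldp_upper hd hlam hlam1.le hF
  lower _ hG := h.ldp_lower hd hlam hlam1 hG

end LDP

/-! ### Explicit rate functions in dimensions one and two. -/

section ClosedForms

variable {d : ℕ} {lam : ℝ}

theorem rateFn_eq_top_of_not (hd : 0 < d) (hlam : 0 ≤ lam) (hlam1 : lam ≤ 1) {x : Fin d → ℝ}
    (h : ¬ ((∀ i, 0 ≤ x i) ∧ ∑ i, x i ≤ 1)) : rateFn lam x = ⊤ := by
  by_contra hne
  exact h (nonneg_of_rateFn_lt_top hd hlam hlam1 (lt_top_iff_ne_top.2 hne))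

/-- The stationary point is e^s = √λ √((1+x)/(1-x)), which escapes to infinity as x → 1. -/
theorem rateFn_one_eq (hlam : 0 < lam) {x : Fin 1 → ℝ} (hx0 : 0 ≤ x 0) (hx1 : x 0 < 1) :
    rateFn lam x = ((x 0 / 2 * Real.log lam - Real.log (rhoLam lam)
      + (1 + x 0) * Real.log (√(1 + x 0)) + (1 - x 0) * Real.log (√(1 - x 0)) : ℝ) : EReal) := by
  have hl : 0 < √lam := Real.sqrt_pos.2 hlam
  have hp : 0 < √(1 + x 0) := Real.sqrt_pos.2 (by linarith)
  have hq : 0 < √(1 - x 0) := Real.sqrt_pos.2 (by linarith)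
  have el := Real.sq_sqrt hlam.le
  have ep := Real.sq_sqrt (by linarith : 0 ≤ 1 + x 0)
  have eq := Real.sq_sqrt (by linarith : 0 ≤ 1 - x 0)
  have hexp : Real.exp (Real.log (√lam * √(1 + x 0) / √(1 - x 0))) =
      √lam * √(1 + x 0) / √(1 - x 0) := Real.exp_log (by positivity)
  have hexpn : lam * Real.exp (-Real.log (√lam * √(1 + x 0) / √(1 - x 0))) =
      √lam * √(1 - x 0) / √(1 + x 0) := by
    rw [Real.exp_neg, hexp]
    field_simp
    exact el.symm
  have hx : ∀ i, 0 ≤ x i := fun i => by rwa [Subsingleton.elim i 0]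
  have hs : IsTilt lam (fun _ : Fin 1 => Real.log (√lam * √(1 + x 0) / √(1 - x 0))) x := by
    intro i
    rw [Subsingleton.elim i 0, Fin.sum_univ_one, hexp, hexpn]
    field_simp
    rw [ep, eq]
    ring
  rw [hs.rateFn_eq one_pos hlam.le hx, EReal.coe_eq_coe_iff]
  have hψ : psi lam (fun _ : Fin 1 => Real.log (√lam * √(1 + x 0) / √(1 - x 0))) =
      rhoLam lam / (√(1 + x 0) * √(1 - x 0)) := by
    have h := hs.psi_mul_eq one_pos hlam.le hx
    rw [Fin.sum_univ_one, hexp, hexpn, ← eq_div_iff (by positivity)] at h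
    rw [h, rhoLam]
    push_cast
    field_simp
    rw [ep, eq]
    ring
  have hρ : 0 < rhoLam lam := by unfold rhoLam; positivity
  rw [tiltValue, hψ, Fin.sum_univ_one, Real.log_div (by positivity) hq.ne',
    Real.log_mul hl.ne' hp.ne', Real.log_div hρ.ne' (by positivity), Real.log_mul hp.ne' hq.ne',
    Real.log_sqrt hlam.le]
  ring

/-- The quantity D factors as A·A' = B·B'. Hence e^{s_1} = √λ A/√D is paired with λe^{-s_1} = √λ
A'/√D, and likewise for B. Stationarity reduces to A - A' = 4x_1, B - B' = 4x_2 and A + A' + B + B'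
= 4. -/
theorem rateFn_two_eq (hlam : 0 < lam) {x : Fin 2 → ℝ} (hx0 : 0 ≤ x 0) (hx1 : 0 ≤ x 1)
    (hx2 : x 0 + x 1 < 1) :
    rateFn lam x = ((1 / 2 * (x 0 + x 1) * Real.log lam - Real.log (rhoLam lam)
      + rateBarTwo (x 0) (x 1) : ℝ) : EReal) := by
  rw [rateBarTwo, if_pos hx2]
  have hx : ∀ i, 0 ≤ x i := Fin.forall_fin_two.2 ⟨hx0, hx1⟩
  set p := x 0 with hp
  set q := x 1 with hq
  set D := (p ^ 2 - q ^ 2) ^ 2 + 1 - 2 * (p ^ 2 + q ^ 2) with hD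
  set A := 2 * p + (p ^ 2 - q ^ 2 + 1) with hA
  set B := 2 * q + (q ^ 2 - p ^ 2 + 1) with hB
  set A' := (p ^ 2 - q ^ 2 + 1) - 2 * p with hA'
  set B' := (q ^ 2 - p ^ 2 + 1) - 2 * q with hB'
  have hA0 : 0 < A := by
    have : A = (1 + p + q) * (1 + p - q) := by rw [hA]; ring
    rw [this]
    exact mul_pos (by linarith) (by linarith)
  have hB0 : 0 < B := by
    have : B = (1 + q + p) * (1 + q - p) := by rw [hB]; ring
    rw [this]
    exact mul_pos (by linarith) (by linarith)
  have hD0 : 0 < D := by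
    have : D = ((1 - p - q) * (1 + p + q)) * ((1 - p + q) * (1 + p - q)) := by rw [hD]; ring
    rw [this]
    exact mul_pos (mul_pos (by linarith) (by linarith)) (mul_pos (by linarith) (by linarith))
  have hAD : A * A' = D := by rw [hA, hA', hD]; ring
  have hBD : B * B' = D := by rw [hB, hB', hD]; ring
  have hl : 0 < √lam := Real.sqrt_pos.2 hlam
  have hR : 0 < √D := Real.sqrt_pos.2 hD0
  have el := Real.sq_sqrt hlam.le
  have eD := Real.sq_sqrt hD0.le
  have hexp : ∀ C C' : ℝ, 0 < C → C * C' = D →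
      Real.exp (1 / 2 * Real.log lam + Real.log (C / √D)) = √lam * C / √D ∧
      lam * Real.exp (-(1 / 2 * Real.log lam + Real.log (C / √D))) = √lam * C' / √D := by
    intro C C' hC hCC
    have h1 : Real.exp (1 / 2 * Real.log lam + Real.log (C / √D)) = √lam * C / √D := by
      rw [Real.exp_add, exp_half_log hlam, Real.exp_log (by positivity), mul_div_assoc]
    refine ⟨h1, ?_⟩
    rw [Real.exp_neg, h1]
    field_simp
    rw [eD, el]
    linear_combination (-lam) * hCC
  obtain ⟨a1, a2⟩ := hexp A A' hA0 hAD
  obtain ⟨b1, b2⟩ := hexp B B' hB0 hBD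
  set s : Fin 2 → ℝ := ![1 / 2 * Real.log lam + Real.log (A / √D),
    1 / 2 * Real.log lam + Real.log (B / √D)] with hs
  have hs0 : s 0 = 1 / 2 * Real.log lam + Real.log (A / √D) := rfl
  have hs1 : s 1 = 1 / 2 * Real.log lam + Real.log (B / √D) := rfl
  have hsum : ∑ j, (Real.exp (s j) + lam * Real.exp (-s j)) = √lam * 4 / √D := by
    rw [Fin.sum_univ_two, hs0, hs1, a1, a2, b1, b2, hA, hA', hB, hB']
    ring
  have ht : IsTilt lam s x := by
    refine Fin.forall_fin_two.2 ⟨?_, ?_⟩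
    · rw [hsum, hs0, a1, a2, hA, hA']
      ring
    · rw [hsum, hs1, b1, b2, hB, hB']
      ring
  have hψ : psi lam s = rhoLam lam / √D := by
    have h := ht.psi_mul_eq two_pos hlam.le hx
    rw [hsum, ← eq_div_iff (by positivity)] at h
    rw [h, rhoLam]
    push_cast
    field_simp
    ring
  have hρ : 0 < rhoLam lam := by unfold rhoLam; positivity
  have h2 : (p ^ 2 - q ^ 2 + 1) + (q ^ 2 - p ^ 2 + 1) = 2 := by ring
  rw [ht.rateFn_eq two_pos hlam.le hx, EReal.coe_eq_coe_iff, tiltValue, hψ, Fin.sum_univ_two,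
    hs0, hs1, h2, Real.log_div hρ.ne' hR.ne', Real.log_div two_ne_zero hR.ne']
  ring

end ClosedForms

/-! ### Assembly of the theorem. -/

open Classical in
theorem theorem3p1 :
    -- Part (i): LDP, good rate function, effective domain and zero set
    (∀ (d : ℕ) (lam : ℝ), (2 ≤ d ∧ 0 ≤ lam) ∨ (d = 1 ∧ 0 < lam) → lam < 1 →
      (∀ (Ω : Type*) [MeasurableSpace Ω] (P : Measure Ω) [IsProbabilityMeasure P]
          (x₀ : Fin d → ℤ) (X : ℕ → Ω → (Fin d → ℤ)), IsBiasedRW P lam x₀ X →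
          SatisfiesLDP (fun n => P.map (scaledReflected X n)) (rateFn (d := d) lam)) ∧
      IsGoodRateFunction (rateFn (d := d) lam) ∧
      (0 < lam →
        {x : Fin d → ℝ | rateFn lam x < ⊤} =
          {x | (∀ i, 0 ≤ x i) ∧ 0 ≤ ∑ i, x i ∧ ∑ i, x i ≤ 1} ∧
        {x : Fin d → ℝ | rateFn lam x = 0} = {fun _ => (1 - lam) / (d * (1 + lam))}) ∧
      (lam = 0 →
        {x : Fin d → ℝ | rateFn lam x < ⊤} = {x | (∀ i, 0 ≤ x i) ∧ ∑ i, x i = 1} ∧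
        {x : Fin d → ℝ | rateFn lam x = 0} = {fun _ => 1 / (d : ℝ)})) ∧
    -- Part (ii): closed form for `d = 1`
    (∀ lam : ℝ, 0 < lam → lam < 1 → ∀ x : Fin 1 → ℝ,
      rateFn lam x =
        if 0 ≤ x 0 ∧ x 0 ≤ 1 then
          ((x 0 / 2 * Real.log lam - Real.log (rhoLam lam)
            + (1 + x 0) * Real.log (√(1 + x 0)) + (1 - x 0) * Real.log (√(1 - x 0)) : ℝ) : EReal)
        else ⊤) ∧
    -- closed form for `d = 2`
    (∀ lam : ℝ, 0 < lam → lam < 1 → ∀ x : Fin 2 → ℝ,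
      rateFn lam x =
        if 0 ≤ x 0 ∧ 0 ≤ x 1 ∧ x 0 + x 1 ≤ 1 then
          ((1 / 2 * (x 0 + x 1) * Real.log lam - Real.log (rhoLam lam)
            + rateBarTwo (x 0) (x 1) : ℝ) : EReal)
        else ⊤) ∧
    -- closed form for `λ = 0`
    (∀ d : ℕ, 2 ≤ d → ∀ x : Fin d → ℝ,
      rateFn 0 x =
        if (∀ i, 0 ≤ x i) ∧ ∑ i, x i = 1 then
          ((Real.log d + ∑ i, x i * Real.log (x i) : ℝ) : EReal)
        else ⊤) := by
  refine ⟨fun d lam hd hlam1 => ?_, fun lam hlam hlam1 x => ?_, fun lam hlam hlam1 x => ?_,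
    fun d hd x => ?_⟩
  · have hd0 : 0 < d := by omega
    have hlam : 0 ≤ lam := hd.elim (fun h => h.2) fun h => h.2.le
    refine ⟨fun Ω _ P _ x₀ X h => h.satisfiesLDP hd0 hlam hlam1,
      isGoodRateFunction_rateFn hd0 hlam hlam1.le, fun hpos => ⟨?_, ?_⟩, fun h0 => ?_⟩
    · ext x
      constructor
      · intro h
        obtain ⟨h1, h2⟩ := nonneg_of_rateFn_lt_top hd0 hlam hlam1.le h
        exact ⟨h1, Finset.sum_nonneg fun i _ => h1 i, h2⟩
      · exact fun h => rateFn_lt_top hd0 hpos h.1 h.2.2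
    · ext x
      constructor
      · exact fun h => funext fun i => eq_mean_of_rateFn_eq_zero hd0 hlam hlam1 h i
      · rintro rfl
        exact rateFn_mean hd0 hlam hlam1.le
    · subst h0
      refine ⟨?_, ?_⟩
      · ext x
        constructor
        · intro h
          obtain ⟨h1, h2⟩ := nonneg_of_rateFn_lt_top hd0 hlam hlam1.le h
          refine ⟨h1, h2.eq_of_not_lt fun hc => ?_⟩
          exact h.ne (rateFn_zero_eq_top_of_lt_one hd0 hc)
        · rintro ⟨h1, h2⟩
          exact lt_of_le_of_lt (rateFn_le_of_sum_eq_one hd0 hlam h1 h2) (EReal.coe_lt_top _)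
      · have hmean : (fun _ => 1 / (d : ℝ) : Fin d → ℝ) =
            fun _ => (1 - 0) / ((d : ℝ) * (1 + 0)) := by
          simp
        rw [hmean]
        ext x
        constructor
        · exact fun h => funext fun i => eq_mean_of_rateFn_eq_zero hd0 hlam hlam1 h i
        · rintro rfl
          exact rateFn_mean hd0 hlam hlam1.le
  · split_ifs with h
    -- At x = 1 there is no stationary point, and the value comes from the entropy formula on the
    -- face ∑ x_i = 1; the same split occurs for d = 2.
    · rcases h.2.eq_or_lt with h1 | h1
      · have hx : ∀ i, 0 ≤ x i := fun i => by rw [Subsingleton.elim i 0]; exact h.1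
        rw [rateFn_of_sum_eq_one one_pos hlam.le hlam1.le hx (by rw [Fin.sum_univ_one, h1]),
          EReal.coe_eq_coe_iff, Fin.sum_univ_one, h1, rhoLam, Real.log_div (by positivity)
          (by positivity), Real.log_mul two_ne_zero (by positivity), Real.log_sqrt hlam.le,
          Real.log_sqrt (by norm_num)]
        norm_num
        ring
      · exact rateFn_one_eq hlam h.1 h1
    · refine rateFn_eq_top_of_not one_pos hlam.le hlam1.le fun hc => h ⟨hc.1 0, ?_⟩
      simpa using hc.2
  · split_ifs with h
    · have hx : ∀ i, 0 ≤ x i := Fin.forall_fin_two.2 ⟨h.1, h.2.1⟩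
      rcases h.2.2.eq_or_lt with h1 | h1
      · rw [rateFn_of_sum_eq_one two_pos hlam.le hlam1.le hx (by rw [Fin.sum_univ_two, h1]),
          EReal.coe_eq_coe_iff, Fin.sum_univ_two, rateBarTwo, if_neg h1.not_lt, h1, rhoLam,
          Real.log_div (by positivity) (by positivity), Real.log_mul two_ne_zero (by positivity),
          Real.log_sqrt hlam.le, Real.log_mul (by norm_num) (by positivity)]
        push_cast
        ring
      · exact rateFn_two_eq hlam h.1 h.2.1 h1
    · refine rateFn_eq_top_of_not two_pos hlam.le hlam1.le fun hc => h ⟨hc.1 0, hc.1 1, ?_⟩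
      simpa using hc.2
  · have hd0 : 0 < d := by omega
    split_ifs with h
    · rw [rateFn_of_sum_eq_one hd0 le_rfl zero_le_one h.1 h.2]
      simp
    · by_contra hne
      obtain ⟨h1, h2⟩ := nonneg_of_rateFn_lt_top hd0 le_rfl zero_le_one (lt_top_iff_ne_top.2 hne)
      exact h ⟨h1, h2.eq_of_not_lt fun hc => hne (rateFn_zero_eq_top_of_lt_one hd0 hc)⟩
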